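/- **Proposition 2.1 (center manifold).** Let $V:\mathbb R^2\to\mathbb R$ be measurable with $|V(x)|\le C\langle x\rangle^{-\rho}$ for all $x\in\mathbb R^2$, for some $C>0$ and $\rho>3$, where $\langle x\rangle=(1+|x|^2)^{1/2}$. Let $H=-\Delta+V$ on $L^2=L^2(\mathbb R^2;\mathbb C)$ with domain $H^2=H^2(\mathbb R^2;\mathbb C)$. Assume that, counting multiplicity, $H$ has exactly one negative eigenvalue $E_0<0$, with eigenvector $\psi_0$ normalized by $\|\psi_0\|_{L^2}=1$. Let $\gamma\in\mathbb R\setminus\{0\}$ and $\sigma\in\mathbb R$, and let $L^2_\sigma$ be the space of functions $u$ with $\langle x\rangle^\sigma u\in L^2$. Write $\langle f,g\rangle=\int_{\mathbb R^2}\overline{f}\,g\,dx$, and consider for real $E$ the nonlinear eigenvalue problem $$(-\Delta+V)\psi+\gamma|\psi|^2\psi=E\psi,\qquad \psi\in H^2. \qquad (\ast)$$ Then there are $\delta_E,\delta,\varepsilon>0$ and a $C^1$ map (in the real sense) $h:\{a\in\mathbb C:|a|<\delta\}\to L^2_\sigma\cap H^2$ with $h(0)=0$ such that, with $\psi_{(a)}:=a\psi_0+h(a)$: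 1. For every $|a|<\delta$: $\langle\psi_0,h(a)\rangle=0$, $h(e^{i\theta}a)=e^{i\theta}h(a)$ for all $\theta\in\mathbb R$, $\|\psi_{(a)}\|_{H^2}<\varepsilon$, and $\psi_{(a)}$ solves $(\ast)$ for some $E$ with $|E-E_0|<\delta_E$. 2. For every $E$ with $|E-E_0|<\delta_E$ and $\gamma(E-E_0)>0$, problem $(\ast)$ has a solution $\psi\ne0$ with $\|\psi\|_{H^2}<\varepsilon$, unique up to multiplication by $e^{i\theta}$, $\theta\in[0,2\pi)$, and it has the form $\psi_E=a\psi_0+h(a)$ with $0<|a|<\delta$. 3. For every $E$ with $|E-E_0|<\delta_E$ and $\gamma(E-E_0)\le0$, the only solution of $(\ast)$ with $\|\psi\|_{H^2}<\varepsilon$ is $\psi=0$. The set $\{a\psi_0+h(a):|a|<\delta\}$ is the center manifold bifurcating from $(E_0,\psi_0)$. -/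

import Mathlib

open MeasureTheory
open scoped SchwartzMap LineDeriv

noncomputable section

namespace NLSCenterManifold

/-- The plane `ℝ²` with its Euclidean norm. -/
abbrev Plane : Type := EuclideanSpace ℝ (Fin 2)

/-- The complex Hilbert space `L²(ℝ²; ℂ)`; its scalar product is
`⟪f, g⟫ = ∫ conj (f x) * g x dx`. -/
abbrev L2 : Type := Lp ℂ 2 (volume : Measure Plane)

/-- The `i`-th standard basis vector of `ℝ²`. -/
def basisVec (i : Fin 2) : Plane := EuclideanSpace.single i 1

/-- `g ∈ L²` is the distributional partial derivative `∂ᵢ f` of `f ∈ L²` (both regarded as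
tempered distributions). -/
def HasDistribDeriv (i : Fin 2) (f g : L2) : Prop :=
  ∂_{basisVec i} (f : 𝓢'(Plane, ℂ)) = (g : 𝓢'(Plane, ℂ))

theorem HasDistribDeriv.zero (i : Fin 2) : HasDistribDeriv i 0 0 := by
  simp only [HasDistribDeriv, ← Lp.toTemperedDistributionCLM_apply, map_zero,
    LineDeriv.lineDerivOp_zero]

theorem HasDistribDeriv.add {i : Fin 2} {f g f' g' : L2} (h : HasDistribDeriv i f g)
    (h' : HasDistribDeriv i f' g') : HasDistribDeriv i (f + f') (g + g') := by
  simp only [HasDistribDeriv, ← Lp.toTemperedDistributionCLM_apply, map_add,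
    LineDeriv.lineDerivOp_add] at *
  rw [h, h']

theorem HasDistribDeriv.smul {i : Fin 2} {f g : L2} (c : ℂ) (h : HasDistribDeriv i f g) :
    HasDistribDeriv i (c • f) (c • g) := by
  simp only [HasDistribDeriv, ← Lp.toTemperedDistributionCLM_apply, map_smul,
    LineDeriv.lineDerivOp_smul] at *
  rw [h]

/-- The Sobolev space `H²(ℝ²; ℂ)` of functions in `L²` with all distributional partial derivatives
up to order two in `L²`. A function `u` is stored together with its (unique) derivatives, as
`(u, (∂ᵢ u)ᵢ, (∂ᵢ ∂ⱼ u)ᵢⱼ)`. The norm is the maximum of the `L²` norms of the components, which is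
equivalent to the usual norm of `H²`. -/
def h2Submodule : Submodule ℂ (L2 × (Fin 2 → L2) × (Fin 2 → Fin 2 → L2)) where
  carrier := {p | (∀ i, HasDistribDeriv i p.1 (p.2.1 i)) ∧
    ∀ i j, HasDistribDeriv i (p.2.1 j) (p.2.2 i j)}
  add_mem' hp hq := ⟨fun i => (hp.1 i).add (hq.1 i), fun i j => (hp.2 i j).add (hq.2 i j)⟩
  zero_mem' := ⟨fun i => HasDistribDeriv.zero i, fun i _ => HasDistribDeriv.zero i⟩
  smul_mem' c _ hp := ⟨fun i => (hp.1 i).smul c, fun i j => (hp.2 i j).smul c⟩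

/-- The normed space `H²(ℝ²; ℂ)`. -/
abbrev H2 : Type := h2Submodule

/-- The function underlying an element of `H²`. -/
def H2.fn (u : H2) : L2 := u.1.1

/-- The Laplacian `Δ u = ∂₁ ∂₁ u + ∂₂ ∂₂ u` of `u ∈ H²`. -/
def H2.laplacian (u : H2) : L2 := ∑ i, u.1.2.2 i i

/-- The weight `⟨x⟩ = (1 + |x|²)^(1/2)`. -/
def japanese (x : Plane) : ℝ := (1 + ‖x‖ ^ 2) ^ (1 / 2 : ℝ)

/-- The space `L²_σ ∩ H²`, where `L²_σ` is the space of all `u` with `⟨x⟩^σ u ∈ L²`. An element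
`u ∈ H²` is stored together with the function `⟨x⟩^σ u ∈ L²`, and the norm is
`max ‖u‖_{H²} ‖⟨x⟩^σ u‖_{L²}`. -/
def weightedH2Submodule (σ : ℝ) : Submodule ℂ (H2 × L2) where
  carrier := {p | ∀ᵐ x, p.2 x = ((japanese x ^ σ : ℝ) : ℂ) * p.1.fn x}
  add_mem' := by
    rintro ⟨u, w⟩ ⟨u', w'⟩ h h'
    filter_upwards [h, h', Lp.coeFn_add w w', Lp.coeFn_add u.fn u'.fn] with x h1 h2 h3 h4
    change (w + w' : L2) x = _ * (u.fn + u'.fn : L2) x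
    rw [h3, h4]
    simp only [Pi.add_apply] at *
    rw [h1, h2, mul_add]
  zero_mem' := by
    filter_upwards [Lp.coeFn_zero ℂ 2 (volume : Measure Plane)] with x h
    change (0 : L2) x = _ * (0 : L2) x
    rw [h]
    simp
  smul_mem' := by
    rintro c ⟨u, w⟩ h
    filter_upwards [h, Lp.coeFn_smul c w, Lp.coeFn_smul c u.fn] with x h1 h2 h3
    change (c • w : L2) x = _ * (c • u.fn : L2) x
    rw [h2, h3]
    simp only [Pi.smul_apply, smul_eq_mul] at *
    rw [h1]
    ring

/-- The normed space `L²_σ ∩ H²`. -/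
abbrev WeightedH2 (σ : ℝ) : Type := weightedH2Submodule σ

/-- The inclusion of `L²_σ ∩ H²` in `H²`. -/
def WeightedH2.toH2 {σ : ℝ} (u : WeightedH2 σ) : H2 := u.1.1

/-- `ψ ∈ H²` satisfies `(-Δ + V) ψ + γ |ψ|² ψ = E ψ` (in `L²`, that is, almost everywhere).
For `γ = 0` this is the linear eigenvalue equation `H ψ = E ψ` of the operator `H = -Δ + V` with
domain `H²`. -/
def SolvesNLS (V : Plane → ℝ) (γ E : ℝ) (ψ : H2) : Prop :=
  ∀ᵐ x, -(ψ.laplacian x) + (V x : ℂ) * ψ.fn x + (γ : ℂ) * ((‖ψ.fn x‖ ^ 2 : ℝ) : ℂ) * ψ.fn x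
    = (E : ℂ) * ψ.fn x

end NLSCenterManifold

end

/-! Put T = -Δ + V - E₀ and look for solutions a(ψ₀ + w) with ⟨ψ₀, w⟩ = 0. The cubic term commutes
with phases and is homogeneous of degree three, so dividing by a leaves T w + tγ|ψ₀ + w|²(ψ₀ + w) =
μ(ψ₀ + w) with t = |a|² and μ = E - E₀ (`BranchEq`), which sees a only through the real number t.

At t = 0 the derivative in (w, μ) at the origin is the bordered operator (w, μ) ↦ (T w - μψ₀, ⟨ψ₀,
w⟩). The potential lies in L² ∩ L^∞, hence is compact relative to -Δ (`isCompactOperator_mulFn`), so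
the bordered operator is a compact perturbation of an isomorphism. Symmetry of T and simplicity of
E₀ make it injective, hence bijective (`bijective_bordered`). The implicit function theorem gives a
C¹ curve (w(t), μ(t)), and h(a) = a w(|a|²) is C¹ and commutes with phases.

Weighted regularity comes from substituting w = W u with W = (1 + η²|x|²)^(-|σ|/2). Multiplication
by W maps H² into L²_σ ∩ H², and for small η it changes -Δ by a small operator (`exists_weight`), so
the same argument solves the conjugated equation. Uniqueness in plain H² is the case W = 1, and it
identifies the two branches (`exists_weighted_branch`).

Pairing the equation with ψ₀ gives γμ(t) = tγ²⟨ψ₀, |ψ₀ + w|²(ψ₀ + w)⟩. At t = 0 the factor of t is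
γ²∫|ψ₀|⁴ > 0, so f = γμ is strictly increasing near 0 (`exists_monotone_branch`). Thus γ(E - E₀) > 0
determines exactly one t = |a|² > 0, and γ(E - E₀) ≤ 0 allows none.

Finally, every small solution is on the branch: the bordered inverse bounds the part of ψ orthogonal
to ψ₀ by a multiple of ‖ψ‖³, so a = ⟨ψ₀, ψ⟩ is nonzero and ψ/a - ψ₀ is small enough for local
uniqueness (`exists_small_solution_bound`, `exists_forall_small_solution`). -/

noncomputable section
namespace NLSCenterManifold
open scoped ENNReal FourierTransform Topology
open Filter

/-! ### Multiplication operators, distributional derivatives and the Fourier transform -/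

/-- Multiplication of `L²` functions by `L^∞` functions. -/
def mulL2 : Lp ℂ ∞ (volume : Measure Plane) →L[ℂ] L2 →L[ℂ] L2 :=
  (ContinuousLinearMap.mul ℂ ℂ).holderL volume ∞ 2 2

theorem coeFn_mulL2 (φ : Lp ℂ ∞ (volume : Measure Plane)) (f : L2) :
    ∀ᵐ x, mulL2 φ f x = φ x * f x :=
  (ContinuousLinearMap.mul ℂ ℂ).coeFn_holder φ f

open Classical in
/-- Multiplication of `L²` functions by a bounded measurable function (zero if the function is not
essentially bounded). -/
def mulFn (φ : Plane → ℂ) : L2 →L[ℂ] L2 :=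
  if h : MemLp φ ∞ (volume : Measure Plane) then mulL2 h.toLp else 0

theorem coeFn_mulFn {φ : Plane → ℂ} (h : MemLp φ ∞ (volume : Measure Plane)) (f : L2) :
    ∀ᵐ x, mulFn φ f x = φ x * f x := by
  rw [mulFn, dif_pos h]
  filter_upwards [coeFn_mulL2 h.toLp f, h.coeFn_toLp] with x h1 h2
  rw [h1, h2]

theorem memLp_top_of_norm_le {φ : Plane → ℂ} (hm : Measurable φ) {C : ℝ}
    (hC : ∀ x, ‖φ x‖ ≤ C) : MemLp φ ∞ (volume : Measure Plane) :=
  memLp_top_of_bound hm.aestronglyMeasurable C (.of_forall hC)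

theorem norm_mulFn_le {φ : Plane → ℂ} (hm : Measurable φ) {C : ℝ}
    (hC : ∀ x, ‖φ x‖ ≤ C) : ‖mulFn φ‖ ≤ C := by
  refine ContinuousLinearMap.opNorm_le_bound _ ((norm_nonneg _).trans (hC 0)) fun f => ?_
  apply Lp.norm_le_mul_norm_of_ae_le_mul
  filter_upwards [coeFn_mulFn (memLp_top_of_norm_le hm hC) f] with x hx
  rw [hx, norm_mul]
  gcongr
  exact hC x

theorem ae_eq_of_forall_integral_schwartz_eq {f g : Plane → ℂ} (hf : LocallyIntegrable f volume)
    (hg : LocallyIntegrable g volume)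
    (h : ∀ u : 𝓢(Plane, ℂ), ∫ x, u x * f x = ∫ x, u x * g x) : f =ᵐ[volume] g := by
  apply ae_eq_of_integral_contDiff_smul_eq hf hg
  intro u hu hcu
  have h1 : HasCompactSupport (Complex.ofRealCLM ∘ u) := hcu.comp_left rfl
  have h2 : ContDiff ℝ (⊤ : ℕ∞) (Complex.ofRealCLM ∘ u) :=
    Complex.ofRealCLM.contDiff.comp hu
  simpa using h (h1.toSchwartzMap h2)

theorem L2.locallyIntegrable (f : L2) : LocallyIntegrable f (volume : Measure Plane) :=
  (Lp.memLp f).locallyIntegrable (by norm_num)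

theorem hasDistribDeriv_iff_integral {i : Fin 2} {f g : L2} :
    HasDistribDeriv i f g ↔
      ∀ u : 𝓢(Plane, ℂ), ∫ x, (∂_{basisVec i} u : 𝓢(Plane, ℂ)) x * f x = -∫ x, u x * g x := by
  rw [HasDistribDeriv]
  constructor
  · intro h u
    have := congrArg (fun T : 𝓢'(Plane, ℂ) => T u) h
    simp only [TemperedDistribution.lineDerivOp_apply_apply, map_neg,
      Lp.toTemperedDistribution_apply, smul_eq_mul] at this
    rw [← this, neg_neg]
  · intro h
    ext u
    simp only [TemperedDistribution.lineDerivOp_apply_apply, map_neg,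
      Lp.toTemperedDistribution_apply, smul_eq_mul]
    rw [h u, neg_neg]

theorem HasDistribDeriv.unique {i : Fin 2} {f g g' : L2} (h : HasDistribDeriv i f g)
    (h' : HasDistribDeriv i f g') : g = g' := by
  rw [hasDistribDeriv_iff_integral] at h h'
  apply Lp.ext
  apply ae_eq_of_forall_integral_schwartz_eq (L2.locallyIntegrable g) (L2.locallyIntegrable g')
  intro u
  rw [← neg_inj, ← h u, h' u]

theorem inner_basisVec (ξ : Plane) (i : Fin 2) : inner ℝ ξ (basisVec i) = ξ i := by
  simp [basisVec, EuclideanSpace.inner_single_right]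

theorem hasDistribDeriv_iff_fourier {i : Fin 2} {f g : L2} :
    HasDistribDeriv i f g ↔
      ∀ᵐ ξ, (𝓕 g : L2) ξ = 2 * Real.pi * Complex.I * (ξ i : ℂ) * (𝓕 f : L2) ξ := by
  have hgr : (fun ξ : Plane => inner ℝ ξ (basisVec i)).HasTemperateGrowth := by fun_prop
  have hgr' : (fun ξ : Plane => ((inner ℝ ξ (basisVec i) : ℝ) : ℂ)).HasTemperateGrowth := by
    fun_prop
  have key : HasDistribDeriv i f g ↔ ∀ u : 𝓢(Plane, ℂ), ∫ ξ, u ξ * (𝓕 g : L2) ξ =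
      ∫ ξ, u ξ * (2 * Real.pi * Complex.I * (ξ i : ℂ) * (𝓕 f : L2) ξ) := by
    have h0 : HasDistribDeriv i f g ↔
        𝓕 (∂_{basisVec i} (f : 𝓢'(Plane, ℂ))) = 𝓕 (g : 𝓢'(Plane, ℂ)) := by
      rw [HasDistribDeriv]
      refine ⟨fun h => by rw [h], fun h => ?_⟩
      have := congrArg 𝓕⁻ h
      simpa using this
    rw [h0, TemperedDistribution.fourier_lineDerivOp_eq, Lp.fourier_toTemperedDistribution_eq,
      Lp.fourier_toTemperedDistribution_eq]
    have h1 : ∀ u : 𝓢(Plane, ℂ), ((2 * Real.pi * Complex.I) • TemperedDistribution.smulLeftCLM ℂ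
        (fun ξ : Plane => ((inner ℝ ξ (basisVec i) : ℝ) : ℂ))
        ((𝓕 f : L2) : 𝓢'(Plane, ℂ))) u =
        ∫ ξ, u ξ * (2 * Real.pi * Complex.I * (ξ i : ℂ) * (𝓕 f : L2) ξ) := by
      intro u
      change (2 * Real.pi * Complex.I) * (TemperedDistribution.smulLeftCLM ℂ
        (fun ξ : Plane => ((inner ℝ ξ (basisVec i) : ℝ) : ℂ))
        ((𝓕 f : L2) : 𝓢'(Plane, ℂ))) u = _
      rw [TemperedDistribution.smulLeftCLM_apply_apply, Lp.toTemperedDistribution_apply,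
        ← integral_const_mul]
      refine integral_congr_ae (.of_forall fun ξ => ?_)
      beta_reduce
      rw [SchwartzMap.smulLeftCLM_apply_apply hgr']
      simp only [inner_basisVec, smul_eq_mul]
      ring
    constructor
    · intro h u
      rw [← h1 u, h, Lp.toTemperedDistribution_apply]
      rfl
    · intro h
      ext u
      rw [h1 u, ← h u, Lp.toTemperedDistribution_apply]
      rfl
  rw [key]
  constructor
  · intro h
    refine ae_eq_of_forall_integral_schwartz_eq (L2.locallyIntegrable _) ?_ h
    rw [locallyIntegrable_iff]
    intro K hK
    exact ((locallyIntegrable_iff.1 (L2.locallyIntegrable (𝓕 f : L2))) K hK).continuousOn_mul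
      (g := fun ξ : Plane => 2 * Real.pi * Complex.I * (ξ i : ℂ)) (by fun_prop) hK
  · intro h u
    refine integral_congr_ae ?_
    filter_upwards [h] with ξ hξ
    rw [hξ]

/-- Differentiation is continuous on tempered distributions, so its graph in L² × L² is closed. The
resulting completeness of H² is needed for the Fredholm alternative and the implicit function
theorem. -/
theorem isClosed_h2Submodule :
    IsClosed (h2Submodule : Set (L2 × (Fin 2 → L2) × (Fin 2 → Fin 2 → L2))) := by
  have hc : ∀ i, IsClosed {p : L2 × L2 | HasDistribDeriv i p.1 p.2} := by
    intro i
    refine isClosed_eq (f := fun p : L2 × L2 => ∂_{basisVec i} (p.1 : 𝓢'(Plane, ℂ)))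
      (g := fun p : L2 × L2 => (p.2 : 𝓢'(Plane, ℂ))) ?_ ?_
    · exact ((LineDeriv.lineDerivOpCLM ℂ 𝓢'(Plane, ℂ) (basisVec i)).continuous.comp
        (Lp.toTemperedDistributionCLM ℂ volume 2).continuous).comp continuous_fst
    · exact (Lp.toTemperedDistributionCLM ℂ volume 2).continuous.comp continuous_snd
  have : (h2Submodule : Set (L2 × (Fin 2 → L2) × (Fin 2 → Fin 2 → L2))) =
      (⋂ i, {p | HasDistribDeriv i p.1 (p.2.1 i)}) ∩
      ⋂ i, ⋂ j, {p | HasDistribDeriv i (p.2.1 j) (p.2.2 i j)} := by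
    ext p
    simp only [Set.mem_inter_iff, Set.mem_iInter]
    rfl
  rw [this]
  refine (isClosed_iInter fun i => ?_).inter (isClosed_iInter fun i => isClosed_iInter fun j => ?_)
  · exact (hc i).preimage (f := fun p : L2 × (Fin 2 → L2) × (Fin 2 → Fin 2 → L2) =>
      (p.1, p.2.1 i)) (by fun_prop)
  · exact (hc i).preimage (f := fun p : L2 × (Fin 2 → L2) × (Fin 2 → Fin 2 → L2) =>
      (p.2.1 j, p.2.2 i j)) (by fun_prop)

instance : CompleteSpace H2 := isClosed_h2Submodule.completeSpace_coe


/-! ### Operators on H², and the isomorphism -Δ + c -/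

/-- The inclusion of `H²` in `L²`. -/
def fnL : H2 →L[ℂ] L2 := (ContinuousLinearMap.fst ℂ _ _).comp h2Submodule.subtypeL

/-- The partial derivative `∂ᵢ` on `H²`. -/
def derivL (i : Fin 2) : H2 →L[ℂ] L2 :=
  (ContinuousLinearMap.proj i).comp <| (ContinuousLinearMap.fst ℂ _ _).comp <|
    (ContinuousLinearMap.snd ℂ _ _).comp h2Submodule.subtypeL

/-- The second partial derivative `∂ᵢ ∂ⱼ` on `H²`. -/
def deriv2L (i j : Fin 2) : H2 →L[ℂ] L2 :=
  (ContinuousLinearMap.proj j).comp <| (ContinuousLinearMap.proj i).comp <|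
    (ContinuousLinearMap.snd ℂ (Fin 2 → L2) (Fin 2 → Fin 2 → L2)).comp <|
    (ContinuousLinearMap.snd ℂ _ _).comp h2Submodule.subtypeL

/-- The Laplacian on `H²`. -/
def lapL : H2 →L[ℂ] L2 := ∑ i, deriv2L i i

theorem fnL_apply (u : H2) : fnL u = u.fn := rfl

theorem lapL_apply (u : H2) : lapL u = u.laplacian := by
  simp only [lapL, sum_apply]
  rfl

theorem hasDistribDeriv_derivL (u : H2) (i : Fin 2) : HasDistribDeriv i u.fn (derivL i u) :=
  u.2.1 i

theorem hasDistribDeriv_deriv2L (u : H2) (i j : Fin 2) :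
    HasDistribDeriv i (derivL j u) (deriv2L i j u) :=
  u.2.2 i j

theorem H2.ext_fn {u v : H2} (h : u.fn = v.fn) : u = v := by
  have h1 : ∀ i, derivL i u = derivL i v := fun i =>
    (hasDistribDeriv_derivL u i).unique (h ▸ hasDistribDeriv_derivL v i)
  have h2 : ∀ i j, deriv2L i j u = deriv2L i j v := fun i j =>
    (hasDistribDeriv_deriv2L u i j).unique (h1 j ▸ hasDistribDeriv_deriv2L v i j)
  apply Subtype.ext
  refine Prod.ext h (Prod.ext (funext h1) (funext fun i => funext fun j => h2 i j))

theorem fourier_lapL (u : H2) :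
    ∀ᵐ ξ, (𝓕 (lapL u) : L2) ξ = -((4 * Real.pi ^ 2 * ‖ξ‖ ^ 2 : ℝ) : ℂ) * (𝓕 u.fn : L2) ξ := by
  have h1 := fun i => hasDistribDeriv_iff_fourier.1 (hasDistribDeriv_derivL u i)
  have h2 := fun i => hasDistribDeriv_iff_fourier.1 (hasDistribDeriv_deriv2L u i i)
  have hs : (𝓕 (lapL u) : L2) = 𝓕 (deriv2L 0 0 u) + 𝓕 (deriv2L 1 1 u) := by
    rw [lapL, Fin.sum_univ_two, add_apply, FourierTransform.fourier_add]
  rw [hs]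
  filter_upwards [h1 0, h1 1, h2 0, h2 1,
    Lp.coeFn_add (𝓕 (deriv2L 0 0 u) : L2) (𝓕 (deriv2L 1 1 u))] with ξ a b c d e
  rw [e, Pi.add_apply, c, d, a, b, EuclideanSpace.norm_sq_eq, Fin.sum_univ_two]
  simp only [Real.norm_eq_abs, sq_abs]
  push_cast
  linear_combination (4 * Real.pi ^ 2 * ((ξ 0 : ℂ) ^ 2 + (ξ 1 : ℂ) ^ 2) * (𝓕 u.fn : L2) ξ) *
    Complex.I_sq

/-- The operator `-Δ + c` on `H²`. -/
def helmholtz (c : ℝ) : H2 →L[ℂ] L2 := (c : ℂ) • fnL - lapL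

theorem fourier_helmholtz (c : ℝ) (u : H2) :
    ∀ᵐ ξ, (𝓕 (helmholtz c u) : L2) ξ =
      ((c + 4 * Real.pi ^ 2 * ‖ξ‖ ^ 2 : ℝ) : ℂ) * (𝓕 u.fn : L2) ξ := by
  have hs : (𝓕 (helmholtz c u) : L2) = (c : ℂ) • 𝓕 u.fn - 𝓕 (lapL u) := by
    rw [helmholtz, sub_apply, sub_eq_add_neg,
      FourierTransform.fourier_add, FourierTransform.fourier_neg, ← sub_eq_add_neg,
      smul_apply, FourierTransform.fourier_smul, fnL_apply]
  rw [hs]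
  filter_upwards [fourier_lapL u, Lp.coeFn_sub ((c : ℂ) • 𝓕 u.fn : L2) (𝓕 (lapL u)),
    Lp.coeFn_smul (c : ℂ) (𝓕 u.fn : L2)] with ξ h1 h2 h3
  rw [h2, Pi.sub_apply, h3, h1, Pi.smul_apply, smul_eq_mul]
  push_cast
  ring

theorem helmholtz_injective {c : ℝ} (hc : 0 < c) : Function.Injective (helmholtz c) := by
  rw [injective_iff_map_eq_zero]
  intro u hu
  apply H2.ext_fn
  have h0 : (𝓕 u.fn : L2) = 0 := by
    have h := fourier_helmholtz c u
    rw [hu, FourierTransform.fourier_zero] at h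
    rw [Lp.eq_zero_iff_ae_eq_zero]
    filter_upwards [h, Lp.coeFn_zero ℂ 2 (volume : Measure Plane)] with ξ h1 h2
    rw [h2, Pi.zero_apply, eq_comm, mul_eq_zero] at h1
    refine h1.resolve_left ?_
    norm_cast
    positivity
  have := congrArg 𝓕⁻ h0
  rw [FourierTransform.fourierInv_fourier_eq, FourierTransform.fourierInv_zero] at this
  exact this

/-- The Fourier symbol of `(-Δ + c)⁻¹`. -/
def symb (c : ℝ) (ξ : Plane) : ℝ := (c + 4 * Real.pi ^ 2 * ‖ξ‖ ^ 2)⁻¹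

theorem measurable_symb (c : ℝ) : Measurable (symb c) := by
  unfold symb
  fun_prop

theorem symb_pos {c : ℝ} (hc : 0 < c) (ξ : Plane) : 0 < symb c ξ := by
  unfold symb
  positivity

/-- One bound that serves the symbols of (-Δ + c)⁻¹ and of its first and second derivatives, all
dominated by 1 + 4π²|ξ|² times `symb c`. -/
theorem symb_mul_le {c : ℝ} (hc : 0 < c) (ξ : Plane) :
    (1 + 4 * Real.pi ^ 2 * ‖ξ‖ ^ 2) * symb c ξ ≤ 1 + c⁻¹ := by
  unfold symb
  rw [← div_eq_mul_inv, div_le_iff₀ (by positivity)]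
  have : 0 ≤ 4 * Real.pi ^ 2 * ‖ξ‖ ^ 2 := by positivity
  set t := 4 * Real.pi ^ 2 * ‖ξ‖ ^ 2
  have h1 : (1 + c⁻¹) * (c + t) = 1 + t + c + c⁻¹ * t := by field_simp; ring
  rw [h1]
  have : 0 ≤ c⁻¹ * t := by positivity
  linarith

theorem abs_coord_le (ξ : Plane) (i : Fin 2) : |ξ i| ≤ ‖ξ‖ := by
  simpa using PiLp.norm_apply_le ξ i

theorem helmholtz_surjective {c : ℝ} (hc : 0 < c) : Function.Surjective (helmholtz c) := by
  intro f
  -- The symbols of u, ∂ᵢu and ∂ᵢ∂ⱼu in terms of f, where u = (-Δ + c)⁻¹ f.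
  let m0 : Plane → ℂ := fun ξ => (symb c ξ : ℂ)
  let m1 : Fin 2 → Plane → ℂ := fun i ξ => 2 * Real.pi * Complex.I * (ξ i : ℂ) * m0 ξ
  let m2 : Fin 2 → Fin 2 → Plane → ℂ := fun i j ξ => 2 * Real.pi * Complex.I * (ξ i : ℂ) * m1 j ξ
  have mm0 : Measurable m0 := Complex.measurable_ofReal.comp (measurable_symb c)
  have mm1 : ∀ i, Measurable (m1 i) := fun i => by fun_prop
  have mm2 : ∀ i j, Measurable (m2 i j) := fun i j => by fun_prop
  have e0 : ∀ ξ, ‖m0 ξ‖ = symb c ξ := fun ξ => by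
    simp only [m0, Complex.norm_real, Real.norm_eq_abs, abs_of_pos (symb_pos hc ξ)]
  have e1 : ∀ i ξ, ‖m1 i ξ‖ = 2 * Real.pi * |ξ i| * symb c ξ := fun i ξ => by
    simp only [m1, norm_mul, e0, Complex.norm_real, Complex.norm_I, Complex.norm_ofNat,
      Real.norm_eq_abs, abs_of_pos Real.pi_pos, mul_one]
  have e2 : ∀ i j ξ, ‖m2 i j ξ‖ = 4 * Real.pi ^ 2 * |ξ i| * |ξ j| * symb c ξ := fun i j ξ => by
    simp only [m2, norm_mul, e1, Complex.norm_real, Complex.norm_I, Complex.norm_ofNat,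
      Real.norm_eq_abs, abs_of_pos Real.pi_pos, mul_one]
    ring
  have b0 : ∀ ξ, ‖m0 ξ‖ ≤ 1 + c⁻¹ := fun ξ => by
    rw [e0]
    refine le_trans ?_ (symb_mul_le hc ξ)
    have := symb_pos hc ξ
    have h : 0 ≤ 4 * Real.pi ^ 2 * ‖ξ‖ ^ 2 := by positivity
    nlinarith
  have b1 : ∀ i ξ, ‖m1 i ξ‖ ≤ 1 + c⁻¹ := fun i ξ => by
    rw [e1]
    refine le_trans ?_ (symb_mul_le hc ξ)
    have := symb_pos hc ξ
    gcongr
    have h := abs_coord_le ξ i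
    have hp : 2 * Real.pi * |ξ i| ≤ 2 * Real.pi * ‖ξ‖ := by gcongr
    nlinarith [sq_nonneg (2 * Real.pi * ‖ξ‖ - 1)]
  have b2 : ∀ i j ξ, ‖m2 i j ξ‖ ≤ 1 + c⁻¹ := fun i j ξ => by
    rw [e2]
    refine le_trans ?_ (symb_mul_le hc ξ)
    have := symb_pos hc ξ
    have h := mul_le_mul (abs_coord_le ξ i) (abs_coord_le ξ j) (abs_nonneg _) (norm_nonneg _)
    gcongr
    rw [mul_assoc (4 * Real.pi ^ 2)]
    have : 4 * Real.pi ^ 2 * (|ξ i| * |ξ j|) ≤ 4 * Real.pi ^ 2 * (‖ξ‖ * ‖ξ‖) := by gcongr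
    nlinarith
  have c0 := coeFn_mulFn (memLp_top_of_norm_le mm0 b0) (𝓕 f)
  have c1 := fun i => coeFn_mulFn (memLp_top_of_norm_le (mm1 i) (b1 i)) (𝓕 f)
  have c2 := fun i j => coeFn_mulFn (memLp_top_of_norm_le (mm2 i j) (b2 i j)) (𝓕 f)
  let u : H2 := ⟨(𝓕⁻ (mulFn m0 (𝓕 f)), fun i => 𝓕⁻ (mulFn (m1 i) (𝓕 f)),
    fun i j => 𝓕⁻ (mulFn (m2 i j) (𝓕 f))), by
    refine ⟨fun i => ?_, fun i j => ?_⟩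
    · rw [hasDistribDeriv_iff_fourier]
      simp only [FourierTransform.fourier_fourierInv_eq]
      filter_upwards [c0, c1 i] with ξ h0 h1
      rw [h0, h1]
      simp only [m1, mul_assoc]
    · rw [hasDistribDeriv_iff_fourier]
      simp only [FourierTransform.fourier_fourierInv_eq]
      filter_upwards [c1 j, c2 i j] with ξ h0 h1
      rw [h0, h1]
      simp only [m2, mul_assoc]⟩
  refine ⟨u, ?_⟩
  have h : (𝓕 (helmholtz c u) : L2) = 𝓕 f := by
    apply Lp.ext
    have hu : (𝓕 u.fn : L2) = mulFn m0 (𝓕 f) := FourierTransform.fourier_fourierInv_eq _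
    have h1 := fourier_helmholtz c u
    rw [hu] at h1
    filter_upwards [h1, c0] with ξ h1 h2
    rw [h1, h2, ← mul_assoc]
    simp only [m0]
    rw [← Complex.ofReal_mul, symb, mul_inv_cancel₀ (by positivity), Complex.ofReal_one, one_mul]
  have := congrArg 𝓕⁻ h
  rwa [FourierTransform.fourierInv_fourier_eq, FourierTransform.fourierInv_fourier_eq] at this

/-- The operator `-Δ + c` as an isomorphism of `H²` with `L²`. -/
theorem exists_helmholtz_equiv {c : ℝ} (hc : 0 < c) :
    ∃ S : H2 ≃L[ℂ] L2, (S : H2 →L[ℂ] L2) = helmholtz c :=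
  ⟨ContinuousLinearEquiv.ofBijective (helmholtz c)
    (LinearMap.ker_eq_bot.2 (helmholtz_injective hc))
    (LinearMap.range_eq_top.2 (helmholtz_surjective hc)), by ext; rfl⟩

/-- The Laplacian is a Fourier multiplier with real symbol; Plancherel makes it symmetric. -/
theorem inner_lapL (u v : H2) : inner ℂ (lapL u) v.fn = inner ℂ u.fn (lapL v) := by
  rw [← Lp.inner_fourier_eq, ← Lp.inner_fourier_eq u.fn, L2.inner_def, L2.inner_def]
  refine integral_congr_ae ?_
  filter_upwards [fourier_lapL u, fourier_lapL v] with ξ h1 h2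
  rw [h1, h2]
  simp only [RCLike.inner_apply, map_mul, map_neg, Complex.conj_ofReal]
  ring

/-! ### Sobolev embedding through point evaluation -/

theorem memLp_two_symb {c : ℝ} (hc : 0 < c) : MemLp (symb c) 2 (volume : Measure Plane) := by
  rw [memLp_two_iff_integrable_sq (measurable_symb c).aestronglyMeasurable]
  -- The square of the symbol decays like |ξ|⁻⁴, which is integrable in the plane because 4 > 2.
  have hi := integrable_rpow_neg_one_add_norm_sq (E := Plane) (μ := volume) (r := 4) (by simp; norm_num)
  refine (hi.const_mul ((1 + c⁻¹) ^ 2)).mono' (by have := measurable_symb c; fun_prop)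
    (.of_forall fun ξ => ?_)
  have h1 := symb_mul_le hc ξ
  have h0 := symb_pos hc ξ
  have h2 : (1 + ‖ξ‖ ^ 2) * symb c ξ ≤ 1 + c⁻¹ := by
    refine le_trans ?_ h1
    gcongr
    have := Real.pi_gt_three
    exact le_mul_of_one_le_left (sq_nonneg _) (by nlinarith)
  have h3 : symb c ξ ≤ (1 + c⁻¹) * (1 + ‖ξ‖ ^ 2)⁻¹ := by
    rw [← div_eq_mul_inv, le_div_iff₀ (by positivity)]
    linarith
  rw [Real.norm_of_nonneg (by positivity)]
  have h4 : (1 + ‖ξ‖ ^ 2 : ℝ) ^ (-4 / 2 : ℝ) = ((1 + ‖ξ‖ ^ 2)⁻¹) ^ 2 := by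
    rw [inv_pow, show (-4 / 2 : ℝ) = -((2 : ℕ) : ℝ) by norm_num, Real.rpow_neg (by positivity),
      Real.rpow_natCast]
  rw [h4, ← mul_pow]
  gcongr

/-- Both sides have the same integral against every Schwartz function, by Fubini. This gives almost
every point value of an L² function whose transform is integrable. -/
theorem ae_eq_fourierInv_of_integrable (f : L2) (h : Integrable (𝓕 f : L2) (volume : Measure Plane)) :
    ∀ᵐ x, f x = 𝓕⁻ (⇑(𝓕 f : L2)) x := by
  have hL : Continuous fun p : Plane × Plane => (-innerₗ Plane) p.1 p.2 := by
    have : Continuous fun p : Plane × Plane => inner ℝ p.1 p.2 := by fun_prop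
    exact this.neg
  have hflip : (-innerₗ Plane).flip = -innerₗ Plane := by
    ext x y
    simp [real_inner_comm]
  refine ae_eq_of_forall_integral_schwartz_eq (L2.locallyIntegrable f) ?_ fun u => ?_
  · exact (VectorFourier.fourierIntegral_continuous Real.continuous_fourierChar hL
      h).locallyIntegrable
  have h1 : (f : 𝓢'(Plane, ℂ)) u = ((𝓕 f : L2) : 𝓢'(Plane, ℂ)) (𝓕⁻ u) := by
    rw [← Lp.fourier_toTemperedDistribution_eq, TemperedDistribution.fourier_apply,
      FourierTransform.fourier_fourierInv_eq]
  rw [Lp.toTemperedDistribution_apply, Lp.toTemperedDistribution_apply] at h1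
  simp only [smul_eq_mul] at h1
  rw [h1]
  have h2 := VectorFourier.integral_fourierIntegral_smul_eq_flip (L := -innerₗ Plane)
    Real.continuous_fourierChar hL (u.integrable (μ := volume)) h
  rw [hflip] at h2
  simp only [smul_eq_mul] at h2
  rw [SchwartzMap.fourierInv_coe]
  exact h2

/-- Point values of functions in `H²`, up to a null set, as bounded functionals of `(-Δ + c) u`. -/
theorem exists_eval {c : ℝ} (hc : 0 < c) :
    ∃ e : Plane → L2, (∃ C, ∀ x, ‖e x‖ ≤ C) ∧
      ∀ u : H2, ∀ᵐ x, u.fn x = inner ℂ (e x) (𝓕 (helmholtz c u) : L2) := by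
  -- The character carries a minus sign because the scalar product conjugates its first argument.
  let e0 : Plane → Plane → ℂ := fun x ξ => (Real.fourierChar (-inner ℝ ξ x) : ℂ) * (symb c ξ : ℂ)
  have hsm : Measurable fun ξ => (symb c ξ : ℂ) := Complex.measurable_ofReal.comp (measurable_symb c)
  have hn : ∀ x ξ, ‖e0 x ξ‖ = ‖symb c ξ‖ := fun x ξ => by
    simp only [e0, norm_mul, Circle.norm_coe, one_mul, Complex.norm_real]
  have hm : ∀ x, Measurable (e0 x) := fun x => by
    have h1 : Continuous fun ξ : Plane => (Real.fourierChar (-inner ℝ ξ x) : ℂ) :=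
      continuous_induced_dom.comp (Real.continuous_fourierChar.comp (by fun_prop))
    exact h1.measurable.mul hsm
  have he : ∀ x, MemLp (e0 x) 2 (volume : Measure Plane) := fun x =>
    (memLp_two_symb hc).of_le (hm x).aestronglyMeasurable (.of_forall fun ξ => (hn x ξ).le)
  refine ⟨fun x => (he x).toLp, ⟨(eLpNorm (symb c) 2 volume).toReal, fun x => ?_⟩, fun u => ?_⟩
  · rw [Lp.norm_toLp, eLpNorm_congr_norm_ae (.of_forall (hn x))]
  have hu : ∀ᵐ ξ, (𝓕 u.fn : L2) ξ = (symb c ξ : ℂ) * (𝓕 (helmholtz c u) : L2) ξ := by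
    filter_upwards [fourier_helmholtz c u] with ξ h1
    rw [h1, ← mul_assoc, ← Complex.ofReal_mul, symb, inv_mul_cancel₀ (by positivity),
      Complex.ofReal_one, one_mul]
  have hi : Integrable (𝓕 u.fn : L2) (volume : Measure Plane) := by
    refine Integrable.congr ?_ (Filter.EventuallyEq.symm hu)
    exact MemLp.integrable_mul (memLp_two_symb hc).ofReal (Lp.memLp _)
  filter_upwards [ae_eq_fourierInv_of_integrable u.fn hi] with x hx
  rw [hx, Real.fourierInv_eq, L2.inner_def]
  refine integral_congr_ae ?_
  filter_upwards [hu, (he x).coeFn_toLp] with ξ h1 h2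
  rw [h1, h2, RCLike.inner_apply, Circle.smul_def]
  simp only [e0, map_mul, Complex.conj_ofReal, smul_eq_mul, ← Circle.coe_inv_eq_conj,
    AddChar.map_neg_eq_inv, inv_inv]
  ring

theorem exists_ae_norm_le :
    ∃ C > 0, ∀ u : H2, ∀ᵐ x, ‖u.fn x‖ ≤ C * ‖u‖ := by
  obtain ⟨e, ⟨C, hC⟩, h⟩ := exists_eval one_pos
  have hC0 : 0 ≤ C := (norm_nonneg _).trans (hC 0)
  refine ⟨C * ‖helmholtz 1‖ + 1, by positivity, fun u => ?_⟩
  filter_upwards [h u] with x hx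
  rw [hx]
  calc _ ≤ ‖e x‖ * ‖(𝓕 (helmholtz 1 u) : L2)‖ := norm_inner_le_norm _ _
    _ ≤ C * (‖helmholtz 1‖ * ‖u‖) := by
      rw [Lp.norm_fourier_eq]
      exact mul_le_mul (hC x) (ContinuousLinearMap.le_opNorm _ _) (norm_nonneg _) hC0
    _ ≤ (C * ‖helmholtz 1‖ + 1) * ‖u‖ := by nlinarith [norm_nonneg u]


/-! ### Relative compactness of multiplication operators -/

theorem L2.norm_sq_eq_integral (f : L2) : ‖f‖ ^ 2 = ∫ x, ‖f x‖ ^ 2 := by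
  rw [← inner_self_eq_norm_sq (𝕜 := ℂ) f, L2.inner_def]
  have h : (fun x => inner ℂ (f x) (f x)) = fun x => ((‖f x‖ ^ 2 : ℝ) : ℂ) := by
    ext x
    rw [inner_self_eq_norm_sq_to_K]
    norm_cast
  rw [h, integral_complex_ofReal]
  exact Complex.ofReal_re _

theorem L2.tendsto_of_dominated {f : ℕ → L2} {G : Plane → ℂ} {B : Plane → ℝ}
    (hB : MemLp B 2 (volume : Measure Plane)) (hfB : ∀ n, ∀ᵐ x, ‖f n x‖ ≤ B x)
    (hG : ∀ᵐ x, Tendsto (fun n => f n x) atTop (𝓝 (G x))) : ∃ g : L2, Tendsto f atTop (𝓝 g) := by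
  have hGm : AEStronglyMeasurable G (volume : Measure Plane) :=
    aestronglyMeasurable_of_tendsto_ae atTop (fun n => (Lp.aestronglyMeasurable (f n))) hG
  have hfB' := ae_all_iff.2 hfB
  have hGB : ∀ᵐ x, ‖G x‖ ≤ B x := by
    filter_upwards [hG, hfB'] with x h1 h2
    exact le_of_tendsto h1.norm (.of_forall h2)
  have hG2 : MemLp G 2 (volume : Measure Plane) := by
    refine hB.of_le hGm ?_
    filter_upwards [hGB] with x hx
    exact hx.trans (le_abs_self _)
  refine ⟨hG2.toLp, ?_⟩
  rw [tendsto_iff_norm_sub_tendsto_zero]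
  have hsq : Tendsto (fun n => ‖f n - hG2.toLp‖ ^ 2) atTop (𝓝 0) := by
    simp_rw [L2.norm_sq_eq_integral]
    have h0 : (0 : ℝ) = ∫ x : Plane, (0 : ℝ) := by simp
    rw [h0]
    refine tendsto_integral_of_dominated_convergence (fun x => 4 * B x ^ 2) (fun n => ?_)
      (hB.integrable_sq.const_mul 4) (fun n => ?_) ?_
    · exact (Lp.aestronglyMeasurable _).norm.pow 2
    · filter_upwards [hfB n, hGB, hG2.coeFn_toLp, Lp.coeFn_sub (f n) hG2.toLp] with x h1 h2 h3 h4
      rw [h4, Pi.sub_apply, h3, Real.norm_of_nonneg (by positivity)]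
      have := norm_sub_le (f n x) (G x)
      have h5 : ‖f n x - G x‖ ≤ 2 * B x := by linarith
      calc _ ≤ (2 * B x) ^ 2 := by gcongr
        _ = _ := by ring
    · filter_upwards [hG, hG2.coeFn_toLp, ae_all_iff.2 fun n => Lp.coeFn_sub (f n) hG2.toLp]
        with x h1 h3 h4
      simp_rw [h4, Pi.sub_apply, h3]
      have := ((h1.sub_const (G x)).norm).pow 2
      simpa using this
  have := hsq.sqrt
  simpa [Real.sqrt_sq (norm_nonneg _)] using this

theorem isCompactOperator_of_tendsto_subseq {X Y : Type*} [NormedAddCommGroup X] [NormedSpace ℂ X]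
    [NormedAddCommGroup Y] [NormedSpace ℂ Y] (K : X →L[ℂ] Y)
    (h : ∀ x : ℕ → X, (∀ n, ‖x n‖ ≤ 1) →
      ∃ y, ∃ φ : ℕ → ℕ, StrictMono φ ∧ Tendsto (fun n => K (x (φ n))) atTop (𝓝 y)) :
    IsCompactOperator K := by
  refine (isCompactOperator_iff_isCompact_closure_image_closedBall
    (K : X →ₗ[ℂ] Y) one_pos).2 ?_
  apply IsSeqCompact.isCompact
  intro y hy
  have hx : ∀ n : ℕ, ∃ x : X, ‖x‖ ≤ 1 ∧ dist (y n) (K x) < 1 / (n + 1 : ℝ) := by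
    intro n
    obtain ⟨_, ⟨x, hx, rfl⟩, hd⟩ := Metric.mem_closure_iff.1 (hy n) (1 / (n + 1 : ℝ)) (by positivity)
    exact ⟨x, by simpa using hx, hd⟩
  choose x hx1 hx2 using hx
  obtain ⟨z, φ, hφ, hz⟩ := h x hx1
  have hlim : Tendsto (fun n => y (φ n)) atTop (𝓝 z) := by
    rw [tendsto_iff_dist_tendsto_zero] at hz ⊢
    have h1 : Tendsto (fun n : ℕ => 1 / ((φ n : ℝ) + 1)) atTop (𝓝 0) :=
      tendsto_one_div_add_atTop_nhds_zero_nat.comp hφ.tendsto_atTop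
    refine squeeze_zero (fun _ => dist_nonneg) (fun n => ?_) (by simpa only [add_zero] using h1.add hz)
    exact (dist_triangle _ (K (x (φ n))) _).trans (add_le_add_left (hx2 _).le _)
  exact ⟨z, isClosed_closure.mem_of_tendsto hlim (.of_forall fun n => hy _), φ, hφ, hlim⟩

/-- Sequential Banach–Alaoglu in the separable space L². The limit is recorded only as a function of
v, since nothing but limits of scalar products is used. -/
theorem L2.exists_weak_subseq (g : ℕ → L2) {C : ℝ} (hg : ∀ n, ‖g n‖ ≤ C) :
    ∃ ψ : L2 → ℂ, ∃ φ : ℕ → ℕ, StrictMono φ ∧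
      ∀ v : L2, Tendsto (fun n => inner ℂ v (g (φ n))) atTop (𝓝 (ψ v)) := by
  have : Fact ((2 : ℝ≥0∞) ≠ ∞) := ⟨by norm_num⟩
  have : SecondCountableTopology L2 := Lp.SecondCountableTopology
  have hs := WeakDual.isSeqCompact_closedBall ℂ L2 0 C
  obtain ⟨w, -, φ, hφ, hw⟩ := hs (x := fun n => StrongDual.toWeakDual (innerSL ℂ (g n)))
    (fun n => by simpa using hg n)
  refine ⟨fun v => starRingEnd ℂ (w v), φ, hφ, fun v => ?_⟩
  have h1 : Tendsto (fun n => inner ℂ (g (φ n)) v) atTop (𝓝 (w v)) :=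
    ((WeakDual.eval_continuous v).tendsto w).comp hw
  have h2 := (Complex.continuous_conj.tendsto (w v)).comp h1
  refine h2.congr fun n => ?_
  simp

/-- Multiplication by a bounded square integrable function is relatively compact with respect to
the Laplacian. -/
theorem isCompactOperator_mulFn {φ : Plane → ℂ} (hb : MemLp φ ∞ (volume : Measure Plane))
    (h2 : MemLp φ 2 (volume : Measure Plane)) : IsCompactOperator (mulFn φ ∘L fnL) := by
  apply isCompactOperator_of_tendsto_subseq
  intro u hu
  obtain ⟨e, ⟨C, hC⟩, he⟩ := exists_eval one_pos
  obtain ⟨C', hC', hbd⟩ := exists_ae_norm_le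
  obtain ⟨ψ, ν, hν, hψ⟩ := L2.exists_weak_subseq (fun n => 𝓕 (helmholtz 1 (u n)))
    (C := ‖helmholtz 1‖) (fun n => by
      rw [Lp.norm_fourier_eq]
      exact (helmholtz 1).le_of_opNorm_le_of_le le_rfl (hu n) |>.trans_eq (mul_one _))
  have hm := fun n => coeFn_mulFn hb (u n).fn
  obtain ⟨g, hg⟩ := L2.tendsto_of_dominated (f := fun n => mulFn φ (u (ν n)).fn)
    (G := fun x => φ x * ψ (e x)) (B := fun x => C' * ‖φ x‖) (h2.norm.const_mul C')
    (fun n => by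
      filter_upwards [hm (ν n), hbd (u (ν n))] with x h1 h3
      rw [h1, norm_mul, mul_comm]
      gcongr
      exact h3.trans (mul_le_of_le_one_right hC'.le (hu _)))
    (by
      filter_upwards [ae_all_iff.2 hm, ae_all_iff.2 fun n => he (u n)] with x h1 h3
      simp_rw [h1, h3]
      exact (hψ (e x)).const_mul _)
  exact ⟨g, ν, hν, hg⟩


/-! ### The Leibniz rule for smooth multipliers on H² -/

theorem mulFn_mul {φ ψ : Plane → ℂ} (hφ : MemLp φ ∞ (volume : Measure Plane))
    (hψ : MemLp ψ ∞ (volume : Measure Plane)) (f : L2) :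
    mulFn (fun x => φ x * ψ x) f = mulFn φ (mulFn ψ f) := by
  apply Lp.ext
  filter_upwards [coeFn_mulFn (hψ.mul' hφ) f, coeFn_mulFn hφ (mulFn ψ f), coeFn_mulFn hψ f]
    with x h1 h2 h3
  rw [h2, h3, ← mul_assoc]
  exact h1

/-- The derivative of f is tested against φu, which is again a Schwartz function; the product rule
in φu yields the term with φ'. -/
theorem HasDistribDeriv.mul_bounded {i : Fin 2} {f g : L2} (h : HasDistribDeriv i f g)
    {φ φ' : Plane → ℂ} (hφ : φ.HasTemperateGrowth) (hb : MemLp φ ∞ (volume : Measure Plane))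
    (hb' : MemLp φ' ∞ (volume : Measure Plane)) (hd : ∀ x, fderiv ℝ φ x (basisVec i) = φ' x) :
    HasDistribDeriv i (mulFn φ f) (mulFn φ g + mulFn φ' f) := by
  rw [hasDistribDeriv_iff_integral] at h ⊢
  intro u
  have hv := h (SchwartzMap.smulLeftCLM ℂ φ u)
  have h1 : ∀ x, (SchwartzMap.smulLeftCLM ℂ φ u) x = φ x * u x := fun x =>
    SchwartzMap.smulLeftCLM_apply_apply hφ u x
  have h2 : ∀ x, (∂_{basisVec i} (SchwartzMap.smulLeftCLM ℂ φ u) : 𝓢(Plane, ℂ)) x =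
      (∂_{basisVec i} u : 𝓢(Plane, ℂ)) x * φ x + u x * φ' x := by
    intro x
    rw [SchwartzMap.lineDerivOp_apply_eq_fderiv, SchwartzMap.lineDerivOp_apply_eq_fderiv,
      SchwartzMap.smulLeftCLM_apply hφ, ← hd x]
    have := fderiv_mul (𝕜 := ℝ) (hφ.1.contDiffAt.differentiableAt (by simp) : DifferentiableAt ℝ φ x)
      u.differentiableAt
    change fderiv ℝ (φ * ⇑u) x _ = _
    rw [this]
    simp only [add_apply, smul_apply, smul_eq_mul]
    ring
  simp_rw [h1, h2] at hv
  have i1 : Integrable (fun x => (∂_{basisVec i} u : 𝓢(Plane, ℂ)) x * mulFn φ f x)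
      (volume : Measure Plane) :=
    MemLp.integrable_mul ((∂_{basisVec i} u : 𝓢(Plane, ℂ)).memLp 2) (Lp.memLp _)
  have i2 : Integrable (fun x => u x * mulFn φ' f x) (volume : Measure Plane) :=
    MemLp.integrable_mul (u.memLp 2) (Lp.memLp _)
  have i3 : Integrable (fun x => u x * mulFn φ g x) (volume : Measure Plane) :=
    MemLp.integrable_mul (u.memLp 2) (Lp.memLp _)
  have e1 : ∫ x, ((∂_{basisVec i} u : 𝓢(Plane, ℂ)) x * φ x + u x * φ' x) * f x =
      (∫ x, (∂_{basisVec i} u : 𝓢(Plane, ℂ)) x * mulFn φ f x) +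
        ∫ x, u x * mulFn φ' f x := by
    rw [← integral_add i1 i2]
    refine integral_congr_ae ?_
    filter_upwards [coeFn_mulFn hb f, coeFn_mulFn hb' f] with x a b
    rw [a, b]
    ring
  have e2 : ∫ x, φ x * u x * g x = ∫ x, u x * mulFn φ g x := by
    refine integral_congr_ae ?_
    filter_upwards [coeFn_mulFn hb g] with x a
    rw [a]
    ring
  have e3 : ∫ x, u x * (mulFn φ g + mulFn φ' f : L2) x =
      (∫ x, u x * mulFn φ g x) + ∫ x, u x * mulFn φ' f x := by
    rw [← integral_add i3 i2]
    refine integral_congr_ae ?_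
    filter_upwards [Lp.coeFn_add (mulFn φ g) (mulFn φ' f)] with x a
    rw [a, Pi.add_apply, mul_add]
  rw [e1, e2] at hv
  rw [e3]
  linear_combination hv

/-- A smooth function `φ` with gradient `φ₁` and Hessian `φ₂`, all of them bounded. -/
structure IsMultiplier (φ : Plane → ℂ) (φ₁ : Fin 2 → Plane → ℂ) (φ₂ : Fin 2 → Fin 2 → Plane → ℂ) :
    Prop where
  growth : φ.HasTemperateGrowth
  growth_grad : ∀ i, (φ₁ i).HasTemperateGrowth
  memLp : MemLp φ ∞ (volume : Measure Plane)
  memLp_grad : ∀ i, MemLp (φ₁ i) ∞ (volume : Measure Plane)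
  memLp_hess : ∀ i j, MemLp (φ₂ i j) ∞ (volume : Measure Plane)
  grad : ∀ i x, fderiv ℝ φ x (basisVec i) = φ₁ i x
  hess : ∀ i j x, fderiv ℝ (φ₁ j) x (basisVec i) = φ₂ i j x

/-- Multiplication of functions in `H²` by smooth functions with bounded derivatives. -/
theorem IsMultiplier.exists_mul {φ : Plane → ℂ} {φ₁ : Fin 2 → Plane → ℂ}
    {φ₂ : Fin 2 → Fin 2 → Plane → ℂ} (h : IsMultiplier φ φ₁ φ₂) :
    ∃ M : H2 →L[ℂ] H2, (∀ u, (M u).fn = mulFn φ u.fn) ∧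
      ∀ u, lapL (M u) = mulFn φ (lapL u) +
        ∑ i, ((2 : ℂ) • mulFn (φ₁ i) (derivL i u) + mulFn (φ₂ i i) u.fn) := by
  let A0 : H2 →L[ℂ] L2 := mulFn φ ∘L fnL
  let A1 : Fin 2 → H2 →L[ℂ] L2 := fun i => mulFn φ ∘L derivL i + mulFn (φ₁ i) ∘L fnL
  let A2 : Fin 2 → Fin 2 → H2 →L[ℂ] L2 := fun i j =>
    (mulFn φ ∘L deriv2L i j + mulFn (φ₁ i) ∘L derivL j) +
      (mulFn (φ₁ j) ∘L derivL i + mulFn (φ₂ i j) ∘L fnL)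
  let A : H2 →L[ℂ] L2 × (Fin 2 → L2) × (Fin 2 → Fin 2 → L2) :=
    A0.prod ((ContinuousLinearMap.pi A1).prod
      (ContinuousLinearMap.pi fun i => ContinuousLinearMap.pi fun j => A2 i j))
  have hA : ∀ u, A u ∈ h2Submodule := fun u =>
    ⟨fun i => (hasDistribDeriv_derivL u i).mul_bounded h.growth h.memLp (h.memLp_grad i) (h.grad i),
      fun i j => ((hasDistribDeriv_deriv2L u i j).mul_bounded h.growth h.memLp (h.memLp_grad i)
        (h.grad i)).add ((hasDistribDeriv_derivL u i).mul_bounded (h.growth_grad j) (h.memLp_grad j)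
          (h.memLp_hess i j) (h.hess i j))⟩
  refine ⟨A.codRestrict h2Submodule hA, fun u => rfl, fun u => ?_⟩
  have : lapL (A.codRestrict h2Submodule hA u) = ∑ i, A2 i i u := by
    simp only [lapL, sum_apply]
    rfl
  rw [this]
  simp only [A2, lapL, sum_apply, add_apply, ContinuousLinearMap.comp_apply, map_sum,
    ← Finset.sum_add_distrib, fnL_apply]
  refine Finset.sum_congr rfl fun i _ => ?_
  module


/-! ### Polynomial weights and conjugation of the Laplacian -/

/-- The powers `(1 + η² |x|²) ^ s`. -/
def bracketPow (η s : ℝ) (x : Plane) : ℝ := (1 + η ^ 2 * ‖x‖ ^ 2) ^ s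

theorem bracketPow_pos (η s : ℝ) (x : Plane) : 0 < bracketPow η s x := by
  unfold bracketPow
  positivity

theorem one_le_bracket (η : ℝ) (x : Plane) : 1 ≤ 1 + η ^ 2 * ‖x‖ ^ 2 := by
  have : 0 ≤ η ^ 2 * ‖x‖ ^ 2 := by positivity
  linarith

theorem bracketPow_le_one {η s : ℝ} (hs : s ≤ 0) (x : Plane) : bracketPow η s x ≤ 1 :=
  Real.rpow_le_one_of_one_le_of_nonpos (one_le_bracket η x) hs

theorem bracketPow_sub_one (η s : ℝ) (x : Plane) :
    bracketPow η (s - 1) x = bracketPow η s x * (1 + η ^ 2 * ‖x‖ ^ 2)⁻¹ := by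
  have := one_le_bracket η x
  rw [bracketPow, Real.rpow_sub_one (by positivity), div_eq_mul_inv, bracketPow]

theorem hasTemperateGrowth_bracketPow (η s : ℝ) : (bracketPow η s).HasTemperateGrowth := by
  have h : bracketPow η s = (fun x : Plane => (1 + ‖x‖ ^ 2) ^ s) ∘ fun x => η • x := by
    ext x
    simp [bracketPow, norm_smul, mul_pow]
  rw [h]
  exact (Function.hasTemperateGrowth_one_add_norm_sq_rpow Plane s).comp (by fun_prop)

theorem hasTemperateGrowth_coord (i : Fin 2) : (fun x : Plane => x i).HasTemperateGrowth := by
  simp_rw [← inner_basisVec]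
  fun_prop

theorem measurable_bracketPow (η s : ℝ) : Measurable (bracketPow η s) :=
  (hasTemperateGrowth_bracketPow η s).1.continuous.measurable

theorem hasFDerivAt_bracketPow (η s : ℝ) (x : Plane) :
    HasFDerivAt (bracketPow η s)
      ((s * bracketPow η (s - 1) x * η ^ 2 * 2) • innerSL ℝ x) x := by
  have h1 : HasFDerivAt (fun x : Plane => 1 + η ^ 2 * ‖x‖ ^ 2) ((η ^ 2 * 2) • innerSL ℝ x) x := by
    refine ((((hasStrictFDerivAt_norm_sq x).hasFDerivAt).const_mul (η ^ 2)).const_add 1).congr_fderiv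
      ?_
    ext v
    simp only [smul_apply, smul_eq_mul, nsmul_eq_mul, Nat.cast_ofNat]
    ring
  refine (h1.rpow_const (p := s) (Or.inl ((zero_lt_one.trans_le
    (one_le_bracket η x)).ne'))).congr_fderiv ?_
  ext v
  simp only [smul_apply, smul_eq_mul, bracketPow]
  ring

theorem fderiv_bracketPow (η s : ℝ) (x : Plane) (i : Fin 2) :
    fderiv ℝ (fun x => (bracketPow η s x : ℂ)) x (basisVec i) =
      ((2 * s * η ^ 2 * x i * bracketPow η (s - 1) x : ℝ) : ℂ) := by
  have h := Complex.ofRealCLM.hasFDerivAt.comp x (hasFDerivAt_bracketPow η s x)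
  rw [show (fun x => (bracketPow η s x : ℂ)) = Complex.ofRealCLM ∘ bracketPow η s from rfl,
    h.fderiv]
  simp [inner_basisVec]
  ring

theorem fderiv_coord_mul_bracketPow (η s : ℝ) (x : Plane) (i j : Fin 2) :
    fderiv ℝ (fun x => ((x j * bracketPow η s x : ℝ) : ℂ)) x (basisVec i) =
      (((if i = j then 1 else 0) * bracketPow η s x +
        2 * s * η ^ 2 * x i * x j * bracketPow η (s - 1) x : ℝ) : ℂ) := by
  have hj : HasFDerivAt (fun x : Plane => x j) (EuclideanSpace.proj j : Plane →L[ℝ] ℝ) x :=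
    (EuclideanSpace.proj j : Plane →L[ℝ] ℝ).hasFDerivAt
  have h := Complex.ofRealCLM.hasFDerivAt.comp x (hj.mul (hasFDerivAt_bracketPow η s x))
  rw [show (fun x : Plane => ((x j * bracketPow η s x : ℝ) : ℂ)) =
    Complex.ofRealCLM ∘ ((fun x : Plane => x j) * bracketPow η s) from rfl, h.fderiv]
  simp only [ContinuousLinearMap.comp_apply, add_apply, smul_apply, smul_eq_mul,
    innerSL_apply_apply, inner_basisVec, Complex.ofRealCLM_apply]
  rw [show (EuclideanSpace.proj j : Plane →L[ℝ] ℝ) (basisVec i) = if i = j then (1 : ℝ) else 0 by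
    simp [basisVec, eq_comm]]
  congr 1
  ring

theorem abs_coord_mul_le (η : ℝ) (x : Plane) (i : Fin 2) :
    |η| * |x i| * (1 + η ^ 2 * ‖x‖ ^ 2)⁻¹ ≤ 1 := by
  have h1 := one_le_bracket η x
  rw [← div_eq_mul_inv, div_le_one (by positivity)]
  have h2 : |η| * |x i| ≤ |η| * ‖x‖ := by gcongr; exact abs_coord_le x i
  nlinarith [sq_nonneg (|η| * ‖x‖ - 1), sq_abs η, mul_pow |η| ‖x‖ 2]

theorem inv_bracket_le (η : ℝ) (x : Plane) : (1 + η ^ 2 * ‖x‖ ^ 2)⁻¹ ≤ 1 :=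
  inv_le_one_of_one_le₀ (one_le_bracket η x)

/-- The logarithmic gradient of `(1 + η² |x|²) ^ (-r)`. -/
def weightGrad (η r : ℝ) (i : Fin 2) (x : Plane) : ℝ :=
  -(2 * r * η ^ 2 * x i) * (1 + η ^ 2 * ‖x‖ ^ 2)⁻¹

/-- The Hessian of `(1 + η² |x|²) ^ (-r)`, divided by this function. -/
def weightHess (η r : ℝ) (i j : Fin 2) (x : Plane) : ℝ :=
  -(2 * r * η ^ 2) * (if i = j then 1 else 0) * (1 + η ^ 2 * ‖x‖ ^ 2)⁻¹ +
    4 * r * (r + 1) * η ^ 4 * x i * x j * ((1 + η ^ 2 * ‖x‖ ^ 2)⁻¹) ^ 2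

theorem measurable_weightGrad (η r : ℝ) (i : Fin 2) : Measurable (weightGrad η r i) := by
  unfold weightGrad
  fun_prop

theorem measurable_weightHess (η r : ℝ) (i j : Fin 2) : Measurable (weightHess η r i j) := by
  unfold weightHess
  fun_prop

/-- The weight depends on ηx only, so each derivative produces a factor η relative to the weight
itself. This is what makes the conjugated Laplacian a small perturbation. -/
theorem abs_weightGrad_le {η r : ℝ} (hη : 0 ≤ η) (hr : 0 ≤ r) (i : Fin 2) (x : Plane) :
    |weightGrad η r i x| ≤ 2 * r * η := by
  have h := abs_coord_mul_le η x i
  have h1 : 0 < (1 + η ^ 2 * ‖x‖ ^ 2)⁻¹ := inv_pos.2 (zero_lt_one.trans_le (one_le_bracket η x))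
  have : |weightGrad η r i x| = 2 * r * η * (|η| * |x i| * (1 + η ^ 2 * ‖x‖ ^ 2)⁻¹) := by
    rw [weightGrad, abs_mul, abs_neg, abs_mul, abs_of_pos h1, abs_of_nonneg (by positivity),
      abs_of_nonneg hη]
    ring
  rw [this]
  exact mul_le_of_le_one_right (by positivity) h

theorem abs_weightHess_le {η r : ℝ} (hη : 0 ≤ η) (hη1 : η ≤ 1) (hr : 0 ≤ r) (i j : Fin 2)
    (x : Plane) : |weightHess η r i j x| ≤ (2 * r + 4 * r * (r + 1)) * η := by
  have hi := abs_coord_mul_le η x i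
  have hj := abs_coord_mul_le η x j
  have h1 : 0 < (1 + η ^ 2 * ‖x‖ ^ 2)⁻¹ := inv_pos.2 (zero_lt_one.trans_le (one_le_bracket η x))
  have h2 := inv_bracket_le η x
  set q := (1 + η ^ 2 * ‖x‖ ^ 2)⁻¹ with hq
  have hη2 : η ^ 2 ≤ η := by nlinarith
  have a1 : |-(2 * r * η ^ 2) * (if i = j then 1 else 0) * q| ≤ 2 * r * η := by
    rw [abs_mul, abs_mul, abs_neg, abs_of_pos h1, abs_of_nonneg (by positivity)]
    have h3 : |(if i = j then (1 : ℝ) else 0)| ≤ 1 := by split_ifs <;> simp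
    calc _ ≤ 2 * r * η ^ 2 * 1 * 1 := by gcongr
      _ ≤ _ := by rw [mul_one, mul_one]; gcongr
  have a2 : |4 * r * (r + 1) * η ^ 4 * x i * x j * q ^ 2| ≤ 4 * r * (r + 1) * η := by
    have : |4 * r * (r + 1) * η ^ 4 * x i * x j * q ^ 2| =
        4 * r * (r + 1) * η ^ 2 * ((|η| * |x i| * q) * (|η| * |x j| * q)) := by
      rw [abs_mul, abs_mul, abs_mul, abs_of_nonneg (by positivity : 0 ≤ q ^ 2),
        abs_of_nonneg (by positivity : 0 ≤ 4 * r * (r + 1) * η ^ 4), abs_of_nonneg hη]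
      ring
    rw [this]
    calc _ ≤ 4 * r * (r + 1) * η ^ 2 * (1 * 1) := by gcongr
      _ ≤ _ := by rw [mul_one, mul_one]; gcongr
  rw [add_mul]
  exact (abs_add_le _ _).trans (add_le_add a1 a2)

theorem grad_eq (η r : ℝ) (i : Fin 2) (x : Plane) :
    2 * (-r) * η ^ 2 * x i * bracketPow η (-r - 1) x = bracketPow η (-r) x * weightGrad η r i x := by
  rw [bracketPow_sub_one, weightGrad]
  ring

theorem hess_eq (η r : ℝ) (i j : Fin 2) (x : Plane) :
    2 * (-r) * η ^ 2 * ((if i = j then 1 else 0) * bracketPow η (-r - 1) x +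
        2 * (-r - 1) * η ^ 2 * x i * x j * bracketPow η (-r - 1 - 1) x) =
      bracketPow η (-r) x * weightHess η r i j x := by
  rw [bracketPow_sub_one η (-r - 1), bracketPow_sub_one η (-r), weightHess]
  ring

theorem isMultiplier_bracketPow {η r : ℝ} (hη : 0 ≤ η) (hη1 : η ≤ 1) (hr : 0 ≤ r) :
    IsMultiplier (fun x => (bracketPow η (-r) x : ℂ))
      (fun i x => (bracketPow η (-r) x : ℂ) * (weightGrad η r i x : ℂ))
      (fun i j x => (bracketPow η (-r) x : ℂ) * (weightHess η r i j x : ℂ)) := by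
  have g1 : ∀ i, (fun x => (bracketPow η (-r) x : ℂ) * (weightGrad η r i x : ℂ)) =
      fun x => ((2 * (-r) * η ^ 2 : ℝ) : ℂ) * ((x i * bracketPow η (-r - 1) x : ℝ) : ℂ) := by
    intro i
    ext x
    rw [← Complex.ofReal_mul, ← grad_eq, ← Complex.ofReal_mul]
    congr 1
    ring
  have t1 : ∀ s, (fun x => (bracketPow η s x : ℂ)).HasTemperateGrowth := fun s =>
    Function.Complex.hasTemperateGrowth_ofReal.comp (hasTemperateGrowth_bracketPow η s)
  have t2 : ∀ (i : Fin 2) s, (fun x : Plane => ((x i * bracketPow η s x : ℝ) : ℂ)).HasTemperateGrowth :=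
    fun i s => Function.Complex.hasTemperateGrowth_ofReal.comp
      ((hasTemperateGrowth_coord i).mul (hasTemperateGrowth_bracketPow η s))
  have m0 : MemLp (fun x => (bracketPow η (-r) x : ℂ)) ∞ (volume : Measure Plane) := by
    refine memLp_top_of_norm_le (C := 1)
      (Complex.measurable_ofReal.comp (measurable_bracketPow η _)) fun x => ?_
    rw [Complex.norm_real, Real.norm_of_nonneg (bracketPow_pos _ _ _).le]
    exact bracketPow_le_one (by linarith) x
  refine ⟨t1 _, fun i => ?_, m0, fun i => ?_, fun i j => ?_, fun i x => ?_, fun i j x => ?_⟩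
  · rw [g1]
    exact (Function.HasTemperateGrowth.const _).mul (t2 i _)
  · refine MemLp.mul' (p := ∞) (q := ∞) (memLp_top_of_norm_le (C := 2 * r * η)
      (Complex.measurable_ofReal.comp (measurable_weightGrad η r i)) fun x => ?_) m0
    rw [Complex.norm_real]
    exact abs_weightGrad_le hη hr i x
  · refine MemLp.mul' (p := ∞) (q := ∞) (memLp_top_of_norm_le
      (C := (2 * r + 4 * r * (r + 1)) * η)
      (Complex.measurable_ofReal.comp (measurable_weightHess η r i j)) fun x => ?_) m0
    rw [Complex.norm_real]
    exact abs_weightHess_le hη hη1 hr i j x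
  · rw [fderiv_bracketPow, grad_eq, Complex.ofReal_mul]
  · rw [g1, fderiv_const_mul ((t2 j _).1.contDiffAt.differentiableAt (by simp)), smul_apply,
      fderiv_coord_mul_bracketPow, smul_eq_mul, ← Complex.ofReal_mul, hess_eq, Complex.ofReal_mul]


theorem japanese_rpow (σ : ℝ) (x : Plane) : japanese x ^ σ = (1 + ‖x‖ ^ 2) ^ (σ / 2) := by
  rw [japanese, ← Real.rpow_mul (by positivity)]
  ring_nf

/-- Since η ≤ 1, η²(1 + |x|²) ≤ 1 + η²|x|². The exponent uses |σ|, which makes the product bounded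
for either sign of σ. -/
theorem japanese_rpow_mul_bracketPow_le {η σ : ℝ} (hη : 0 < η) (hη1 : η ≤ 1) (x : Plane) :
    japanese x ^ σ * bracketPow η (-(|σ| / 2)) x ≤ (η ^ 2) ^ (-(|σ| / 2)) := by
  have h0 : (1 : ℝ) ≤ 1 + ‖x‖ ^ 2 := by have := sq_nonneg ‖x‖; linarith
  have h1 : η ^ 2 * (1 + ‖x‖ ^ 2) ≤ 1 + η ^ 2 * ‖x‖ ^ 2 := by nlinarith
  have h2 : bracketPow η (-(|σ| / 2)) x ≤ (η ^ 2 * (1 + ‖x‖ ^ 2)) ^ (-(|σ| / 2)) :=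
    Real.rpow_le_rpow_of_nonpos (by positivity) h1 (by have := abs_nonneg σ; linarith)
  rw [Real.mul_rpow (by positivity) (by positivity)] at h2
  have h3 : (1 + ‖x‖ ^ 2) ^ (σ / 2) * (1 + ‖x‖ ^ 2) ^ (-(|σ| / 2)) ≤ 1 := by
    rw [← Real.rpow_add (by positivity)]
    exact Real.rpow_le_one_of_one_le_of_nonpos h0 (by have := le_abs_self σ; linarith)
  have h4 : 0 ≤ (η ^ 2) ^ (-(|σ| / 2)) := by positivity
  rw [japanese_rpow]
  calc _ ≤ (1 + ‖x‖ ^ 2) ^ (σ / 2) * ((η ^ 2) ^ (-(|σ| / 2)) * (1 + ‖x‖ ^ 2) ^ (-(|σ| / 2))) := by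
        gcongr
    _ = (η ^ 2) ^ (-(|σ| / 2)) * ((1 + ‖x‖ ^ 2) ^ (σ / 2) * (1 + ‖x‖ ^ 2) ^ (-(|σ| / 2))) := by ring
    _ ≤ _ := mul_le_of_le_one_right h4 h3

/-- Multiplication by a slowly decaying weight maps `H²` to `L²_σ ∩ H²`, and conjugates the Laplacian
to a small perturbation of itself. -/
theorem exists_weight (σ : ℝ) {d : ℝ} (hd : 0 < d) :
    ∃ (W : Plane → ℝ) (B : H2 →L[ℂ] L2) (M : H2 →L[ℂ] H2) (Mσ : H2 →L[ℂ] WeightedH2 σ),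
      Measurable W ∧ (∀ x, 0 < W x) ∧ (∀ x, W x ≤ 1) ∧ ‖B‖ ≤ d ∧
      (∀ u, (M u).fn = mulFn (fun x => (W x : ℂ)) u.fn) ∧
      (∀ u, lapL (M u) = mulFn (fun x => (W x : ℂ)) (lapL u - B u)) ∧
      ∀ u, (Mσ u).toH2 = M u := by
  set r := |σ| / 2 with hr
  have hr0 : 0 ≤ r := by positivity
  set K := ∑ i : Fin 2, (2 * (2 * r) * ‖derivL i‖ + (2 * r + 4 * r * (r + 1)) * ‖fnL‖) with hK
  have hK0 : 0 ≤ K := Finset.sum_nonneg fun i _ => by positivity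
  -- K bounds the norm of the perturbation divided by η; K + 1 in the denominator avoids a division
  -- by zero.
  obtain ⟨η, hη, hη1, hηd⟩ : ∃ η : ℝ, 0 < η ∧ η ≤ 1 ∧ K * η ≤ d := by
    refine ⟨min 1 (d / (K + 1)), by positivity, min_le_left _ _, ?_⟩
    calc K * min 1 (d / (K + 1)) ≤ (K + 1) * (d / (K + 1)) := by
          gcongr
          · linarith
          · exact min_le_right _ _
      _ = d := by field_simp
  have hm := isMultiplier_bracketPow hη.le hη1 hr0
  obtain ⟨M, hM, hML⟩ := hm.exists_mul
  have mb : ∀ i, Measurable fun x => (weightGrad η r i x : ℂ) := fun i =>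
    Complex.measurable_ofReal.comp (measurable_weightGrad η r i)
  have mc : ∀ i j, Measurable fun x => (weightHess η r i j x : ℂ) := fun i j =>
    Complex.measurable_ofReal.comp (measurable_weightHess η r i j)
  have nb : ∀ i x, ‖(weightGrad η r i x : ℂ)‖ ≤ 2 * r * η := fun i x => by
    rw [Complex.norm_real]
    exact abs_weightGrad_le hη.le hr0 i x
  have nc : ∀ i j x, ‖(weightHess η r i j x : ℂ)‖ ≤ (2 * r + 4 * r * (r + 1)) * η := fun i j x => by
    rw [Complex.norm_real]
    exact abs_weightHess_le hη.le hη1 hr0 i j x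
  -- B = -(2 (∇W/W)·∇ + ΔW/W), read off from Δ(Wu) = W Δu + 2∇W·∇u + uΔW.
  let B : H2 →L[ℂ] L2 := -∑ i, ((2 : ℂ) • (mulFn (fun x => (weightGrad η r i x : ℂ)) ∘L derivL i) +
    mulFn (fun x => (weightHess η r i i x : ℂ)) ∘L fnL)
  have mJ : Measurable fun x => ((japanese x ^ σ * bracketPow η (-r) x : ℝ) : ℂ) := by
    have := measurable_bracketPow η (-r)
    unfold japanese
    fun_prop
  have nJ : ∀ x, ‖((japanese x ^ σ * bracketPow η (-r) x : ℝ) : ℂ)‖ ≤ (η ^ 2) ^ (-(|σ| / 2)) := by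
    intro x
    rw [Complex.norm_real, Real.norm_of_nonneg]
    · exact japanese_rpow_mul_bracketPow_le hη hη1 x
    · have := (bracketPow_pos η (-r) x).le
      rw [japanese_rpow]
      positivity
  let A : H2 →L[ℂ] H2 × L2 :=
    M.prod (mulFn (fun x => ((japanese x ^ σ * bracketPow η (-r) x : ℝ) : ℂ)) ∘L fnL)
  have hA : ∀ u, A u ∈ weightedH2Submodule σ := by
    intro u
    change ∀ᵐ x, mulFn (fun x => ((japanese x ^ σ * bracketPow η (-r) x : ℝ) : ℂ)) u.fn x =
      ((japanese x ^ σ : ℝ) : ℂ) * (M u).fn x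
    rw [hM]
    filter_upwards [coeFn_mulFn (memLp_top_of_norm_le mJ nJ) u.fn, coeFn_mulFn hm.memLp u.fn]
      with x h1 h2
    rw [h1, h2]
    push_cast
    ring
  refine ⟨bracketPow η (-r), B, M, A.codRestrict _ hA, measurable_bracketPow _ _,
    bracketPow_pos _ _, bracketPow_le_one (by linarith), ?_, hM, fun u => ?_, fun u => rfl⟩
  · refine ContinuousLinearMap.opNorm_le_bound _ hd.le fun u => ?_
    have hBu : ‖B u‖ = ‖∑ i, ((2 : ℂ) • mulFn (fun x => (weightGrad η r i x : ℂ)) (derivL i u) +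
        mulFn (fun x => (weightHess η r i i x : ℂ)) (fnL u))‖ := by
      rw [← norm_neg]
      simp only [B, neg_apply, sum_apply, add_apply, smul_apply, ContinuousLinearMap.comp_apply]
      rw [neg_neg]
    rw [hBu]
    refine le_trans ?_ (mul_le_mul_of_nonneg_right hηd (norm_nonneg u))
    rw [hK, Finset.sum_mul, Finset.sum_mul]
    refine norm_sum_le_of_le _ fun i _ => (norm_add_le _ _).trans ?_
    rw [norm_smul, Complex.norm_ofNat, add_mul, add_mul]
    have h1 := (mulFn (fun x => (weightGrad η r i x : ℂ))).le_of_opNorm_le_of_le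
      (norm_mulFn_le (mb i) (nb i)) ((derivL i).le_opNorm u)
    have h2 := (mulFn (fun x => (weightHess η r i i x : ℂ))).le_of_opNorm_le_of_le
      (norm_mulFn_le (mc i i) (nc i i)) (fnL.le_opNorm u)
    refine add_le_add ?_ (h2.trans_eq (by ring))
    calc _ ≤ 2 * (2 * r * η * (‖derivL i‖ * ‖u‖)) := by gcongr
      _ = _ := by ring
  · rw [hML]
    have e1 : ∀ i (f : L2), mulFn (fun x => (bracketPow η (-r) x : ℂ) * (weightGrad η r i x : ℂ)) f =
        mulFn (fun x => (bracketPow η (-r) x : ℂ)) (mulFn (fun x => (weightGrad η r i x : ℂ)) f) :=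
      fun i f => mulFn_mul hm.memLp (memLp_top_of_norm_le (mb i) (nb i)) f
    have e2 : ∀ i (f : L2), mulFn (fun x => (bracketPow η (-r) x : ℂ) * (weightHess η r i i x : ℂ)) f =
        mulFn (fun x => (bracketPow η (-r) x : ℂ)) (mulFn (fun x => (weightHess η r i i x : ℂ)) f) :=
      fun i f => mulFn_mul hm.memLp (memLp_top_of_norm_le (mc i i) (nc i i)) f
    simp only [e1, e2, B, neg_apply, sum_apply, add_apply, smul_apply,
      ContinuousLinearMap.comp_apply, fnL_apply, sub_neg_eq_add, map_add, map_sum, map_smul]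


/-! ### The cubic nonlinearity as a smooth map from H² to L² -/

theorem H2.memLp_top (u : H2) : MemLp u.fn ∞ (volume : Measure Plane) := by
  obtain ⟨C, -, h⟩ := exists_ae_norm_le
  exact memLp_top_of_bound (Lp.aestronglyMeasurable _) _ (h u)

theorem exists_H2_toLinf :
    ∃ J : H2 →L[ℂ] Lp ℂ ∞ (volume : Measure Plane), ∀ u : H2, ∀ᵐ x, J u x = u.fn x := by
  obtain ⟨C, hC, h⟩ := exists_ae_norm_le
  let J0 : H2 →ₗ[ℂ] Lp ℂ ∞ (volume : Measure Plane) :=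
    { toFun := fun u => u.memLp_top.toLp
      map_add' := fun u v => by
        apply Lp.ext
        filter_upwards [(u + v).memLp_top.coeFn_toLp, u.memLp_top.coeFn_toLp,
          v.memLp_top.coeFn_toLp, Lp.coeFn_add u.memLp_top.toLp v.memLp_top.toLp,
          Lp.coeFn_add u.fn v.fn] with x h1 h2 h3 h4 h5
        rw [h1, h4, Pi.add_apply, h2, h3]
        exact h5
      map_smul' := fun c u => by
        apply Lp.ext
        filter_upwards [(c • u).memLp_top.coeFn_toLp, u.memLp_top.coeFn_toLp,
          Lp.coeFn_smul c u.memLp_top.toLp, Lp.coeFn_smul c u.fn] with x h1 h2 h4 h5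
        rw [h1, RingHom.id_apply, h4, Pi.smul_apply, h2]
        exact h5 }
  refine ⟨J0.mkContinuous C fun u => ?_, fun u => u.memLp_top.coeFn_toLp⟩
  change ‖u.memLp_top.toLp‖ ≤ _
  rw [Lp.norm_toLp, eLpNorm_exponent_top]
  exact ENNReal.toReal_le_of_le_ofReal (by positivity) (eLpNormEssSup_le_of_ae_bound (h u))

/-- The embedding of `H²` in `L^∞`. -/
def toLinf : H2 →L[ℂ] Lp ℂ ∞ (volume : Measure Plane) := exists_H2_toLinf.choose

theorem coeFn_toLinf (u : H2) : ∀ᵐ x, toLinf u x = u.fn x := exists_H2_toLinf.choose_spec u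

/-- Complex conjugation on `L^∞`. -/
def conjLinf : Lp ℂ ∞ (volume : Measure Plane) →L[ℝ] Lp ℂ ∞ (volume : Measure Plane) :=
  (Complex.conjCLE : ℂ →L[ℝ] ℂ).compLpL ∞ volume

theorem coeFn_conjLinf (φ : Lp ℂ ∞ (volume : Measure Plane)) :
    ∀ᵐ x, conjLinf φ x = starRingEnd ℂ (φ x) :=
  (Complex.conjCLE : ℂ →L[ℝ] ℂ).coeFn_compLpL φ

/-- The function `|u|²` for `u ∈ H²`. -/
def absSq (u : H2) : L2 := mulL2 (conjLinf (toLinf u)) u.fn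

/-- The cubic nonlinearity `|u|² u`. -/
def cubic (u : H2) : L2 := mulL2 (toLinf u) (absSq u)

theorem coeFn_absSq (u : H2) : ∀ᵐ x, absSq u x = starRingEnd ℂ (u.fn x) * u.fn x := by
  filter_upwards [coeFn_mulL2 (conjLinf (toLinf u)) u.fn, coeFn_conjLinf (toLinf u), coeFn_toLinf u]
    with x h1 h2 h3
  rw [absSq, h1, h2, h3]

theorem coeFn_cubic (u : H2) : ∀ᵐ x, cubic u x = ((‖u.fn x‖ ^ 2 : ℝ) : ℂ) * u.fn x := by
  filter_upwards [coeFn_absSq u, coeFn_mulL2 (toLinf u) (absSq u), coeFn_toLinf u]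
    with x h1 h2 h3
  rw [cubic, h2, h1, h3, Complex.conj_mul']
  push_cast
  ring

/-- A composition of bounded bilinear and linear maps. The conjugation c is only real linear, so
smoothness holds over ℝ only. -/
theorem contDiff_bilin_bilin {X A Y : Type*} [NormedAddCommGroup X] [NormedSpace ℂ X]
    [NormedSpace ℝ X] [IsScalarTower ℝ ℂ X] [NormedAddCommGroup A] [NormedSpace ℂ A]
    [NormedSpace ℝ A] [IsScalarTower ℝ ℂ A] [NormedAddCommGroup Y] [NormedSpace ℂ Y]
    [NormedSpace ℝ Y] [IsScalarTower ℝ ℂ Y] {n : WithTop ℕ∞} (m : A →L[ℂ] Y →L[ℂ] Y)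
    (J : X →L[ℂ] A) (c : A →L[ℝ] A) (ι : X →L[ℂ] Y) :
    ContDiff ℝ n fun u => m (J u) (m (c (J u)) (ι u)) := by
  have hb : ContDiff ℝ n fun p : A × Y => m p.1 p.2 :=
    (m.isBoundedBilinearMap.contDiff).restrict_scalars ℝ
  have h1 : ContDiff ℝ n fun u => J u := J.contDiff.restrict_scalars ℝ
  have h2 : ContDiff ℝ n fun u => ι u := ι.contDiff.restrict_scalars ℝ
  exact hb.comp (h1.prodMk (hb.comp ((c.contDiff.comp h1).prodMk h2)))

theorem contDiff_cubic {n : WithTop ℕ∞} : ContDiff ℝ n cubic :=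
  contDiff_bilin_bilin mulL2 toLinf conjLinf fnL

theorem norm_absSq_le (u : H2) :
    ‖absSq u‖ ≤ ‖mulL2‖ * (‖conjLinf‖ * (‖toLinf‖ * ‖u‖)) * (‖fnL‖ * ‖u‖) := by
  have h1 : ‖conjLinf (toLinf u)‖ ≤ ‖conjLinf‖ * (‖toLinf‖ * ‖u‖) :=
    conjLinf.le_of_opNorm_le_of_le le_rfl (toLinf.le_opNorm u)
  have h2 : ‖u.fn‖ ≤ ‖fnL‖ * ‖u‖ := fnL.le_opNorm u
  refine (mulL2.le_opNorm₂ _ _).trans ?_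
  gcongr

theorem norm_cubic_le (u : H2) : ‖cubic u‖ ≤ ‖mulL2‖ * (‖toLinf‖ * ‖u‖) *
    (‖mulL2‖ * (‖conjLinf‖ * (‖toLinf‖ * ‖u‖)) * (‖fnL‖ * ‖u‖)) := by
  have h1 : ‖toLinf u‖ ≤ ‖toLinf‖ * ‖u‖ := toLinf.le_opNorm u
  have h3 := norm_absSq_le u
  refine (mulL2.le_opNorm₂ _ _).trans ?_
  gcongr

theorem exists_norm_cubic_le : ∃ C ≥ 0, ∀ u, ‖cubic u‖ ≤ C * ‖u‖ ^ 3 :=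
  ⟨‖mulL2‖ * ‖toLinf‖ * (‖mulL2‖ * (‖conjLinf‖ * ‖toLinf‖) * ‖fnL‖), by positivity,
    fun u => (norm_cubic_le u).trans_eq (by ring)⟩

theorem cubic_smul (c : ℂ) (u : H2) :
    cubic (c • u) = (((‖c‖ ^ 2 : ℝ) : ℂ) * c) • cubic u := by
  apply Lp.ext
  filter_upwards [coeFn_cubic u, coeFn_cubic (c • u), Lp.coeFn_smul c u.fn,
    Lp.coeFn_smul (((‖c‖ ^ 2 : ℝ) : ℂ) * c) (cubic u)] with x h1 h2 h3 h4
  have h5 : (c • u).fn x = c * u.fn x := h3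
  rw [h2, h4, h5, Pi.smul_apply, h1, norm_mul, smul_eq_mul]
  push_cast
  ring

/-- The value is ∫|u|⁴. Its positivity fixes the direction of bifurcation and its reality makes the
energy shift real. -/
theorem inner_cubic (u : H2) : inner ℂ u.fn (cubic u) = ((‖absSq u‖ ^ 2 : ℝ) : ℂ) := by
  have : inner ℂ u.fn (cubic u) = inner ℂ (absSq u) (absSq u) := by
    rw [L2.inner_def, L2.inner_def]
    refine integral_congr_ae ?_
    filter_upwards [coeFn_cubic u, coeFn_absSq u] with x h1 h2
    rw [h1, h2, RCLike.inner_apply, RCLike.inner_apply, Complex.conj_mul']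
    simp only [map_pow, Complex.conj_ofReal]
    rw [mul_assoc, Complex.mul_conj']
    push_cast
    ring
  rw [this, inner_self_eq_norm_sq_to_K]
  norm_cast

theorem absSq_ne_zero {u : H2} (hu : u ≠ 0) : absSq u ≠ 0 := by
  intro h
  apply hu
  apply H2.ext_fn
  apply Lp.ext
  have h1 := coeFn_absSq u
  rw [h] at h1
  filter_upwards [h1, Lp.coeFn_zero ℂ 2 (volume : Measure Plane)] with x h2 h3
  rw [h3, Pi.zero_apply, Complex.conj_mul', eq_comm] at h2
  have h4 : u.fn x = 0 := by simpa using h2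
  rw [h4]
  exact h3.symm

/-- The nonlinearity gains W³. One factor is cancelled in the conjugated equation, leaving the
bounded factor W². -/
theorem cubic_eq_mulFn {W : Plane → ℝ} (hW : MemLp (fun x => (W x : ℂ)) ∞ (volume : Measure Plane))
    {u v : H2} (h : v.fn = mulFn (fun x => (W x : ℂ)) u.fn) :
    cubic v = mulFn (fun x => (W x : ℂ)) (mulFn (fun x => (W x : ℂ))
      (mulFn (fun x => (W x : ℂ)) (cubic u))) := by
  apply Lp.ext
  have h0 := coeFn_mulFn hW u.fn
  rw [← h] at h0
  filter_upwards [coeFn_cubic u, coeFn_cubic v, h0, coeFn_mulFn hW (cubic u),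
    coeFn_mulFn hW (mulFn (fun x => (W x : ℂ)) (cubic u)),
    coeFn_mulFn hW (mulFn (fun x => (W x : ℂ)) (mulFn (fun x => (W x : ℂ)) (cubic u)))]
    with x h1 h2 h3 h4 h5 h6
  rw [h2, h3, h6, h5, h4, h1, norm_mul, Complex.norm_real, mul_pow, Real.norm_eq_abs, sq_abs]
  push_cast
  ring

/-! ### The Schrödinger operator and its symmetry -/

/-- The operator `-Δ + V - E` on `H²`. -/
def schrodinger (V : Plane → ℝ) (E : ℝ) : H2 →L[ℂ] L2 :=
  helmholtz (-E) + mulFn (fun x => (V x : ℂ)) ∘L fnL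

theorem coeFn_schrodinger {V : Plane → ℝ}
    (hV : MemLp (fun x => (V x : ℂ)) ∞ (volume : Measure Plane)) (E : ℝ) (u : H2) :
    ∀ᵐ x, schrodinger V E u x = -(u.laplacian x) + (V x : ℂ) * u.fn x - (E : ℂ) * u.fn x := by
  have h : schrodinger V E u =
      (((-E : ℝ) : ℂ) • u.fn - u.laplacian) + mulFn (fun x => (V x : ℂ)) u.fn := by
    rw [← lapL_apply]
    rfl
  rw [h]
  filter_upwards [Lp.coeFn_add (((-E : ℝ) : ℂ) • u.fn - u.laplacian)
    (mulFn (fun x => (V x : ℂ)) u.fn), Lp.coeFn_sub (((-E : ℝ) : ℂ) • u.fn) u.laplacian,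
    Lp.coeFn_smul ((-E : ℝ) : ℂ) u.fn, coeFn_mulFn hV u.fn] with x h1 h2 h3 h4
  rw [h1, Pi.add_apply, h2, Pi.sub_apply, h3, Pi.smul_apply, h4, smul_eq_mul]
  push_cast
  ring

theorem solvesNLS_iff {V : Plane → ℝ}
    (hV : MemLp (fun x => (V x : ℂ)) ∞ (volume : Measure Plane)) (γ E₀ E : ℝ) (u : H2) :
    SolvesNLS V γ E u ↔
      schrodinger V E₀ u + (γ : ℂ) • cubic u = ((E - E₀ : ℝ) : ℂ) • u.fn := by
  rw [SolvesNLS, Lp.ext_iff]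
  apply Filter.eventually_congr
  filter_upwards [coeFn_schrodinger hV E₀ u, coeFn_cubic u, Lp.coeFn_smul (γ : ℂ) (cubic u),
    Lp.coeFn_add (schrodinger V E₀ u) ((γ : ℂ) • cubic u),
    Lp.coeFn_smul ((E - E₀ : ℝ) : ℂ) u.fn] with x h1 h2 h3 h4 h5
  rw [h4, h5, Pi.add_apply, Pi.smul_apply, h3, h1, Pi.smul_apply, h2]
  simp only [smul_eq_mul]
  push_cast
  constructor
  · intro h
    linear_combination h
  · intro h
    linear_combination h

theorem inner_mulFn_ofReal {W : Plane → ℝ}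
    (hW : MemLp (fun x => (W x : ℂ)) ∞ (volume : Measure Plane)) (f g : L2) :
    inner ℂ (mulFn (fun x => (W x : ℂ)) f) g = inner ℂ f (mulFn (fun x => (W x : ℂ)) g) := by
  rw [L2.inner_def, L2.inner_def]
  refine integral_congr_ae ?_
  filter_upwards [coeFn_mulFn hW f, coeFn_mulFn hW g] with x h1 h2
  rw [h1, h2]
  simp only [RCLike.inner_apply, map_mul, Complex.conj_ofReal]
  ring

theorem inner_schrodinger {V : Plane → ℝ}
    (hV : MemLp (fun x => (V x : ℂ)) ∞ (volume : Measure Plane)) (E : ℝ) (u v : H2) :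
    inner ℂ (schrodinger V E u) v.fn = inner ℂ u.fn (schrodinger V E v) := by
  have h : ∀ u, schrodinger V E u =
      (((-E : ℝ) : ℂ) • u.fn - lapL u) + mulFn (fun x => (V x : ℂ)) u.fn := fun u => rfl
  rw [h, h, inner_add_left, inner_add_right, inner_sub_left, inner_sub_right, inner_smul_left,
    inner_smul_right, inner_lapL, inner_mulFn_ofReal hV, Complex.conj_ofReal]

theorem mulFn_ofReal_injective {W : Plane → ℝ}
    (hW : MemLp (fun x => (W x : ℂ)) ∞ (volume : Measure Plane)) (h0 : ∀ x, 0 < W x) :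
    Function.Injective (mulFn fun x => (W x : ℂ)) := by
  intro f g h
  apply Lp.ext
  have h1 := coeFn_mulFn hW f
  rw [h] at h1
  filter_upwards [h1, coeFn_mulFn hW g] with x h1 h2
  rw [h2] at h1
  exact (mul_left_cancel₀ (Complex.ofReal_ne_zero.2 (h0 x).ne') h1).symm


/-! ### Fredholm alternative and bifurcation by the implicit function theorem -/

section Abstract

variable {X Y : Type*} [NormedAddCommGroup X] [NormedSpace ℂ X] [CompleteSpace X]
  [NormedAddCommGroup Y] [NormedSpace ℂ Y]

/-- The Fredholm alternative for compact perturbations of isomorphisms. -/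
theorem bijective_of_injective_add_compact (S : X ≃L[ℂ] Y) {K : X →L[ℂ] Y}
    (hK : IsCompactOperator K)
    (hinj : Function.Injective ((S : X →L[ℂ] Y) + K)) :
    Function.Bijective ((S : X →L[ℂ] Y) + K) := by
  let K' : X →L[ℂ] X := (S.symm : Y →L[ℂ] X) ∘L K
  have hK' : IsCompactOperator K' := hK.clm_comp (S.symm : Y →L[ℂ] X)
  have hS : ∀ x, ((S : X →L[ℂ] Y) + K) x = S (x + K' x) := fun x => by
    simp [K']
  -- S⁻¹(S + K) = 1 + S⁻¹K: either -1 is an eigenvalue of the compact operator S⁻¹K, against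
  -- injectivity, or 1 + S⁻¹K is invertible.
  rcases hK'.hasEigenvalue_or_mem_resolventSet (μ := (-1 : ℂ)) (by norm_num) with h | h
  · obtain ⟨x, hx⟩ := h.exists_hasEigenvector
    have h1 : K' x = (-1 : ℂ) • x := hx.apply_eq_smul
    exfalso
    apply hx.2
    apply hinj
    rw [hS, h1, map_zero]
    simp
  · rw [spectrum.mem_resolventSet_iff, ContinuousLinearMap.isUnit_iff_bijective] at h
    refine ⟨hinj, fun y => ?_⟩
    obtain ⟨x, hx⟩ := h.2 (-S.symm y)
    refine ⟨x, ?_⟩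
    have h2 : x + K' x = S.symm y := by
      have h3 : -x - K' x = -S.symm y := by
        rw [← hx]
        simp
      rw [← neg_inj, ← h3]
      abel
    rw [hS, h2, S.apply_symm_apply]

theorem exists_equiv_add (S : X ≃L[ℂ] Y) :
    ∃ d > 0, ∀ B : X →L[ℂ] Y, ‖B‖ ≤ d → ∃ S' : X ≃L[ℂ] Y, (S' : X →L[ℂ] Y) = S + B := by
  obtain ⟨d, hd, h⟩ := Metric.mem_nhds_iff.1 (ContinuousLinearEquiv.nhds S)
  refine ⟨d / 2, by positivity, fun B hB => ?_⟩
  have : (S : X →L[ℂ] Y) + B ∈ Metric.ball (S : X →L[ℂ] Y) d := by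
    rw [mem_ball_iff_norm, add_sub_cancel_left]
    linarith
  exact h this

variable [CompleteSpace Y] [NormedSpace ℝ X] [IsScalarTower ℝ ℂ X] [NormedSpace ℝ Y] [IsScalarTower ℝ ℂ Y]

/-- The branch of solutions `(k, μ)` of `A k + t N (v + k) = μ (v + k)`, `ℓ k = 0`, obtained from the
implicit function theorem at a simple eigenvalue. -/
theorem exists_branch (A ι : X →L[ℂ] Y) (ℓ : X →L[ℂ] ℂ) {N : X → Y} (hN : ContDiff ℝ 1 N) (v : X)
    (hbij : Function.Bijective fun p : X × ℂ => (A p.1 - p.2 • ι v, ℓ p.1)) :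
    ∃ (k : ℝ → X) (μ : ℝ → ℂ), ContDiffAt ℝ 1 k 0 ∧ ContDiffAt ℝ 1 μ 0 ∧ k 0 = 0 ∧ μ 0 = 0 ∧
      (∀ᶠ t in 𝓝 (0 : ℝ), A (k t) + t • N (v + k t) = μ t • ι (v + k t) ∧ ℓ (k t) = 0) ∧
      ∀ᶠ q : ℝ × X × ℂ in 𝓝 0, A q.2.1 + q.1 • N (v + q.2.1) = q.2.2 • ι (v + q.2.1) →
        ℓ q.2.1 = 0 → k q.1 = q.2.1 ∧ μ q.1 = q.2.2 := by
  let F : ℝ × (X × ℂ) → Y × ℂ := fun q =>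
    (A q.2.1 + q.1 • N (v + q.2.1) - q.2.2 • ι (v + q.2.1), ℓ q.2.1)
  have hA : ContDiff ℝ 1 fun x => A x := A.contDiff.restrict_scalars ℝ
  have hι : ContDiff ℝ 1 fun x => ι x := ι.contDiff.restrict_scalars ℝ
  have hℓ : ContDiff ℝ 1 fun x => ℓ x := ℓ.contDiff.restrict_scalars ℝ
  have hF : ContDiff ℝ 1 F := by fun_prop
  have hF0 : F 0 = 0 := by simp [F]
  let L : X × ℂ →L[ℂ] Y × ℂ :=
    (A.comp (ContinuousLinearMap.fst ℂ X ℂ) -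
      (ContinuousLinearMap.snd ℂ X ℂ).smulRight (ι v)).prod (ℓ.comp (ContinuousLinearMap.fst ℂ X ℂ))
  have hLbij : Function.Bijective (L.restrictScalars ℝ) := hbij
  have hL : fderiv ℝ F 0 ∘L .inr ℝ ℝ (X × ℂ) = L.restrictScalars ℝ := by
    have h1 : HasFDerivAt (fun p : X × ℂ => F (0, p)) (fderiv ℝ F 0 ∘L .inr ℝ ℝ (X × ℂ)) 0 := by
      have := (hF.differentiable one_ne_zero (0 : ℝ × (X × ℂ))).hasFDerivAt
      exact HasFDerivAt.comp (g := F) (f := fun p : X × ℂ => ((0 : ℝ), p)) 0 this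
        (ContinuousLinearMap.inr ℝ ℝ (X × ℂ)).hasFDerivAt
    -- At t = 0 the nonlinear term, which is only real differentiable, disappears; the partial
    -- derivative can be computed over ℂ.
    have h2 : HasFDerivAt (fun p : X × ℂ => F (0, p)) L 0 := by
      have ha : HasFDerivAt (fun p : X × ℂ => A p.1) (A.comp (ContinuousLinearMap.fst ℂ X ℂ)) 0 :=
        (A.comp (ContinuousLinearMap.fst ℂ X ℂ)).hasFDerivAt
      have hi : HasFDerivAt (fun p : X × ℂ => ι (v + p.1))
          (ι.comp (ContinuousLinearMap.fst ℂ X ℂ)) 0 := by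
        simp_rw [map_add]
        exact (ι.comp (ContinuousLinearMap.fst ℂ X ℂ)).hasFDerivAt.const_add _
      have hs : HasFDerivAt (fun p : X × ℂ => p.2) (ContinuousLinearMap.snd ℂ X ℂ) 0 :=
        (ContinuousLinearMap.snd ℂ X ℂ).hasFDerivAt
      have hl : HasFDerivAt (fun p : X × ℂ => ℓ p.1) (ℓ.comp (ContinuousLinearMap.fst ℂ X ℂ)) 0 :=
        (ℓ.comp (ContinuousLinearMap.fst ℂ X ℂ)).hasFDerivAt
      have h := (ha.sub (hs.smul hi)).prodMk hl
      have h3 : (fun p : X × ℂ => F (0, p)) =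
          fun p => (A p.1 - p.2 • ι (v + p.1), ℓ p.1) := by
        ext p <;> simp [F]
      rw [h3]
      refine h.congr_fderiv ?_
      ext p <;> simp [L]
    exact h1.unique (h2.restrictScalars ℝ)
  have hinv : (fderiv ℝ F 0 ∘L .inr ℝ ℝ (X × ℂ)).IsInvertible := by
    rw [hL]
    exact ⟨ContinuousLinearEquiv.ofBijective (L.restrictScalars ℝ)
      (LinearMap.ker_eq_bot.2 hLbij.1) (LinearMap.range_eq_top.2 hLbij.2),
      ContinuousLinearMap.ext fun _ => rfl⟩
  have cdf : ContDiffAt ℝ 1 F 0 := hF.contDiffAt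
  set g := cdf.implicitFunction one_ne_zero hinv with hg
  have hgc : ContDiffAt ℝ 1 g 0 := cdf.contDiffAt_implicitFunction one_ne_zero hinv
  have hg0 : g 0 = 0 := cdf.implicitFunction_apply_self one_ne_zero hinv
  refine ⟨fun t => (g t).1, fun t => (g t).2, hgc.fst, hgc.snd, by simp [hg0], by simp [hg0], ?_, ?_⟩
  · filter_upwards [cdf.eventually_apply_implicitFunction one_ne_zero hinv] with t ht
    rw [hF0] at ht
    exact ⟨sub_eq_zero.1 (congrArg Prod.fst ht), congrArg Prod.snd ht⟩
  · filter_upwards [cdf.eventually_apply_eq_iff_implicitFunction one_ne_zero hinv] with q hq h1 h2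
    rw [hF0] at hq
    have : F q = 0 := Prod.ext (sub_eq_zero.2 h1) h2
    have h3 := hq.1 this
    exact ⟨congrArg Prod.fst h3, congrArg Prod.snd h3⟩

end Abstract


/-- The Fredholm alternative for a compact perturbation of an isomorphism, bordered by one row and
one column. -/
theorem bijective_bordered {X Y : Type*} [NormedAddCommGroup X] [NormedSpace ℂ X] [CompleteSpace X]
    [NormedAddCommGroup Y] [NormedSpace ℂ Y] (S : X ≃L[ℂ] Y) {K : X →L[ℂ] Y}
    (hK : IsCompactOperator K) {A : X →L[ℂ] Y} (hA : A = S + K) (ℓ : X →L[ℂ] ℂ) (y : Y)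
    (hinj : ∀ x : X, ∀ c : ℂ, A x = c • y → ℓ x = 0 → x = 0 ∧ c = 0) :
    Function.Bijective fun p : X × ℂ => (A p.1 - p.2 • y, ℓ p.1) := by
  let K₁ : X × ℂ →L[ℂ] Y × ℂ := .inl ℂ Y ℂ ∘L K ∘L .fst ℂ X ℂ
  -- The reference isomorphism is S × id on X × ℂ. The entry -1 removes this identity, since the
  -- bordered operator has a zero in that corner.
  let K₂ : X × ℂ →L[ℂ] Y × ℂ := ((1 : ℂ →L[ℂ] ℂ).smulRight ((-y, -1) : Y × ℂ)) ∘L .snd ℂ X ℂ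
  let K₃ : X × ℂ →L[ℂ] Y × ℂ := .inr ℂ Y ℂ ∘L ℓ ∘L .fst ℂ X ℂ
  have h₁ : IsCompactOperator K₁ :=
    (hK.comp_clm (ContinuousLinearMap.fst ℂ X ℂ)).clm_comp (ContinuousLinearMap.inl ℂ Y ℂ)
  have h₂ : IsCompactOperator K₂ :=
    (isCompactOperator_of_locallyCompactSpace_rng
      ((1 : ℂ →L[ℂ] ℂ).smulRight ((-y, -1) : Y × ℂ))).comp_clm (ContinuousLinearMap.snd ℂ X ℂ)
  have h₃ : IsCompactOperator K₃ :=
    (isCompactOperator_of_locallyCompactSpace_dom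
      (ℓ ∘L ContinuousLinearMap.fst ℂ X ℂ)).clm_comp (ContinuousLinearMap.inr ℂ Y ℂ)
  let S' : (X × ℂ) ≃L[ℂ] (Y × ℂ) := S.prodCongr (.refl ℂ ℂ)
  have key : (fun p : X × ℂ => (A p.1 - p.2 • y, ℓ p.1)) =
      ⇑((S' : X × ℂ →L[ℂ] Y × ℂ) + (K₁ + K₂ + K₃)) := by
    funext p
    apply Prod.ext
    · simp [S', K₁, K₂, K₃, hA]
      abel
    · simp [S', K₁, K₂, K₃]
  have hinj' : Function.Injective ((S' : X × ℂ →L[ℂ] Y × ℂ) + (K₁ + K₂ + K₃)) := by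
    rw [injective_iff_map_eq_zero]
    intro p hp
    rw [← key] at hp
    obtain ⟨h1, h2⟩ := hinj p.1 p.2 (sub_eq_zero.1 (congrArg Prod.fst hp)) (congrArg Prod.snd hp)
    exact Prod.ext h1 h2
  rw [key]
  exact bijective_of_injective_add_compact S' ((h₁.add h₂).add h₃) hinj'

theorem clm_map_real_smul {X Y : Type*} [NormedAddCommGroup X] [NormedSpace ℂ X]
    [NormedSpace ℝ X] [IsScalarTower ℝ ℂ X] [NormedAddCommGroup Y] [NormedSpace ℂ Y]
    [NormedSpace ℝ Y] [IsScalarTower ℝ ℂ Y] (T : X →L[ℂ] Y) (t : ℝ) (x : X) :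
    T (t • x) = t • T x := by
  rw [← one_smul ℂ x, ← smul_assoc, map_smul, map_smul, smul_assoc]

theorem _root_.ContDiffAt.clm_complex_apply {X Y : Type*} [NormedAddCommGroup X] [NormedSpace ℂ X]
    [NormedSpace ℝ X] [IsScalarTower ℝ ℂ X] [NormedAddCommGroup Y] [NormedSpace ℂ Y]
    [NormedSpace ℝ Y] [IsScalarTower ℝ ℂ Y] {n : WithTop ℕ∞} {k : ℝ → X} {t : ℝ}
    (hk : ContDiffAt ℝ n k t) (T : X →L[ℂ] Y) : ContDiffAt ℝ n (fun t => T (k t)) t :=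
  (T.contDiff.restrict_scalars ℝ).contDiffAt.comp t hk

/-! ### The conjugated operator, its kernel and its bordered inverse -/

/-- Multiplication by the positive bounded function `W` intertwines `-Δ + V - E` with an operator
`A` that is a compact perturbation of an isomorphism. -/
structure IsConjugation (V : Plane → ℝ) (E : ℝ) (W : Plane → ℝ) (M : H2 →L[ℂ] H2)
    (A : H2 →L[ℂ] L2) : Prop where
  memLp : MemLp (fun x => (W x : ℂ)) ∞ (volume : Measure Plane)
  pos : ∀ x, 0 < W x
  fn_apply : ∀ u, (M u).fn = mulFn (fun x => (W x : ℂ)) u.fn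
  schrodinger_apply : ∀ u, schrodinger V E (M u) = mulFn (fun x => (W x : ℂ)) (A u)
  exists_add : ∃ (S : H2 ≃L[ℂ] L2) (K : H2 →L[ℂ] L2), IsCompactOperator K ∧ A = S + K

theorem mulFn_one : mulFn (fun _ => ((1 : ℝ) : ℂ)) = ContinuousLinearMap.id ℂ L2 := by
  ext1 f
  apply Lp.ext
  have h1 : MemLp (fun _ : Plane => ((1 : ℝ) : ℂ)) ∞ (volume : Measure Plane) :=
    memLp_top_of_norm_le measurable_const (C := 1) (by simp)
  filter_upwards [coeFn_mulFn h1 f] with x h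
  rw [h]
  simp

theorem isConjugation_id {V : Plane → ℝ}
    (hV : MemLp (fun x => (V x : ℂ)) ∞ (volume : Measure Plane))
    (hV2 : MemLp (fun x => (V x : ℂ)) 2 (volume : Measure Plane)) {E : ℝ} (hE : E < 0) :
    IsConjugation V E (fun _ => 1) (ContinuousLinearMap.id ℂ H2) (schrodinger V E) where
  memLp := memLp_top_of_norm_le measurable_const (C := 1) (by simp)
  pos := fun _ => one_pos
  fn_apply := fun u => by rw [mulFn_one]; rfl
  schrodinger_apply := fun u => by rw [mulFn_one]; rfl
  exists_add := by
    obtain ⟨S, hS⟩ := exists_helmholtz_equiv (neg_pos.2 hE)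
    exact ⟨S, _, isCompactOperator_mulFn hV hV2, by rw [hS]; rfl⟩

theorem exists_isConjugation {V : Plane → ℝ}
    (hV : MemLp (fun x => (V x : ℂ)) ∞ (volume : Measure Plane))
    (hV2 : MemLp (fun x => (V x : ℂ)) 2 (volume : Measure Plane)) {E : ℝ} (hE : E < 0) (σ : ℝ) :
    ∃ (W : Plane → ℝ) (M : H2 →L[ℂ] H2) (A : H2 →L[ℂ] L2) (Mσ : H2 →L[ℂ] WeightedH2 σ),
      IsConjugation V E W M A ∧ ∀ u, (Mσ u).toH2 = M u := by
  obtain ⟨S, hS⟩ := exists_helmholtz_equiv (neg_pos.2 hE)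
  obtain ⟨d, hd, hS'⟩ := exists_equiv_add S
  obtain ⟨W, B, M, Mσ, mW, hW0, hW1, hB, hM, hML, hMσ⟩ := exists_weight σ hd
  obtain ⟨S', hSB⟩ := hS' B hB
  have hW : MemLp (fun x => (W x : ℂ)) ∞ (volume : Measure Plane) :=
    memLp_top_of_norm_le (Complex.measurable_ofReal.comp mW) (C := 1) fun x => by
      rw [Complex.norm_real, Real.norm_of_nonneg (hW0 x).le]
      exact hW1 x
  refine ⟨W, M, schrodinger V E + B, Mσ, ⟨hW, hW0, hM, fun u => ?_, S', _,
    isCompactOperator_mulFn hV hV2, ?_⟩, hMσ⟩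
  · have h1 : schrodinger V E (M u) =
        (((-E : ℝ) : ℂ) • (M u).fn - lapL (M u)) + mulFn (fun x => (V x : ℂ)) (M u).fn := rfl
    have h2 : (schrodinger V E + B) u =
        ((((-E : ℝ) : ℂ) • u.fn - lapL u) + mulFn (fun x => (V x : ℂ)) u.fn) + B u := rfl
    have h3 : mulFn (fun x => (V x : ℂ)) (mulFn (fun x => (W x : ℂ)) u.fn) =
        mulFn (fun x => (W x : ℂ)) (mulFn (fun x => (V x : ℂ)) u.fn) := by
      rw [← mulFn_mul hV hW, ← mulFn_mul hW hV]
      simp_rw [mul_comm]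
    rw [h1, h2, hM, hML, h3]
    simp only [map_add, map_sub, map_smul]
    abel
  · rw [hSB, hS, schrodinger]
    abel

section Eigenvector

variable {V : Plane → ℝ} {E : ℝ} {W : Plane → ℝ} {M : H2 →L[ℂ] H2} {A : H2 →L[ℂ] L2} {ψ₀ : H2}

theorem IsConjugation.injective (hc : IsConjugation V E W M A) : Function.Injective M := by
  intro u v h
  apply H2.ext_fn
  apply mulFn_ofReal_injective hc.memLp hc.pos
  rw [← hc.fn_apply, h, hc.fn_apply]

theorem inner_schrodinger_eq_zero (hV : MemLp (fun x => (V x : ℂ)) ∞ (volume : Measure Plane))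
    (h₀ : schrodinger V E ψ₀ = 0) (u : H2) : inner ℂ ψ₀.fn (schrodinger V E u) = 0 := by
  rw [← inner_schrodinger hV, h₀, inner_zero_left]

/-- Shows that ψ₀ itself is W times an H² function, hence decays. If A were injective it would be
onto, so A v = Wψ₀ for some v; pairing W A v, which is in the range of the symmetric operator, with
its kernel vector ψ₀ gives ‖Wψ₀‖² = 0. So A has a kernel, and M maps it into the span of ψ₀. -/
theorem IsConjugation.exists_kernel (hc : IsConjugation V E W M A)
    (hV : MemLp (fun x => (V x : ℂ)) ∞ (volume : Measure Plane))
    (hnorm : ‖ψ₀.fn‖ = 1) (h₀ : schrodinger V E ψ₀ = 0)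
    (hker : ∀ φ, schrodinger V E φ = 0 → ∃ c : ℂ, φ = c • ψ₀) :
    ∃ v, M v = ψ₀ ∧ A v = 0 := by
  by_cases hinj : Function.Injective A
  · obtain ⟨S, K, hK, hA⟩ := hc.exists_add
    have hbij : Function.Bijective A := by
      rw [hA] at hinj ⊢
      exact bijective_of_injective_add_compact S hK hinj
    obtain ⟨v, hv⟩ := hbij.2 (mulFn (fun x => (W x : ℂ)) ψ₀.fn)
    have h1 := inner_schrodinger_eq_zero hV h₀ (M v)
    rw [hc.schrodinger_apply, hv, ← inner_mulFn_ofReal hc.memLp, inner_self_eq_zero] at h1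
    have h2 : ψ₀.fn = 0 := mulFn_ofReal_injective hc.memLp hc.pos (by rw [h1, map_zero])
    rw [h2, norm_zero] at hnorm
    exact absurd hnorm zero_ne_one
  · rw [injective_iff_map_eq_zero] at hinj
    push Not at hinj
    obtain ⟨v, hv, hv0⟩ := hinj
    obtain ⟨c, hcv⟩ := hker (M v) (by rw [hc.schrodinger_apply, hv, map_zero])
    have hc0 : c ≠ 0 := by
      rintro rfl
      apply hv0
      apply hc.injective
      rw [hcv, zero_smul, map_zero]
    exact ⟨c⁻¹ • v, by rw [map_smul, hcv, smul_smul, inv_mul_cancel₀ hc0, one_smul],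
      by rw [map_smul, hv, smul_zero]⟩

/-- The coefficient of `ψ₀`, as a functional on `H²`. -/
def coeffL (ψ₀ : H2) : H2 →L[ℂ] ℂ := innerSL ℂ ψ₀.fn ∘L fnL

theorem coeffL_apply (ψ₀ u : H2) : coeffL ψ₀ u = inner ℂ ψ₀.fn u.fn := rfl

theorem coeffL_self (hnorm : ‖ψ₀.fn‖ = 1) : coeffL ψ₀ ψ₀ = 1 := by
  rw [coeffL_apply, inner_self_eq_norm_sq_to_K, hnorm]
  simp

/-- If A x = c v, then the Schrödinger operator sends M x to cψ₀. Pairing with ψ₀ forces c = 0; then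
M x is a multiple of ψ₀ orthogonal to ψ₀, hence zero. -/
theorem IsConjugation.bijective_bordered (hc : IsConjugation V E W M A)
    (hV : MemLp (fun x => (V x : ℂ)) ∞ (volume : Measure Plane))
    (hnorm : ‖ψ₀.fn‖ = 1) (h₀ : schrodinger V E ψ₀ = 0)
    (hker : ∀ φ, schrodinger V E φ = 0 → ∃ c : ℂ, φ = c • ψ₀) {v : H2} (hv : M v = ψ₀) :
    Function.Bijective fun p : H2 × ℂ => (A p.1 - p.2 • fnL v, (coeffL ψ₀ ∘L M) p.1) := by
  obtain ⟨S, K, hK, hA⟩ := hc.exists_add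
  refine NLSCenterManifold.bijective_bordered S hK hA _ _ fun x c h1 h2 => ?_
  have h2' : coeffL ψ₀ (M x) = 0 := h2
  have h3 : schrodinger V E (M x) = c • ψ₀.fn := by
    rw [hc.schrodinger_apply, h1, map_smul, fnL_apply, ← hc.fn_apply, hv]
  have h4 := inner_schrodinger_eq_zero hV h₀ (M x)
  rw [h3, inner_smul_right, ← coeffL_apply, coeffL_self hnorm, mul_one] at h4
  refine ⟨?_, h4⟩
  rw [h4, zero_smul] at h3
  obtain ⟨a, ha⟩ := hker _ h3
  rw [ha, map_smul, coeffL_self hnorm, smul_eq_mul, mul_one] at h2'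
  apply hc.injective
  rw [ha, h2', zero_smul, map_zero]

/-! ### The bifurcating branch -/

/-- The equation satisfied by `ψ₀ + w`, `t = |a|²`, when `a (ψ₀ + w)` is a nonlinear bound state. -/
def BranchEq (V : Plane → ℝ) (γ E : ℝ) (ψ₀ : H2) (t : ℝ) (w : H2) (μ : ℂ) : Prop :=
  schrodinger V E w + t • (γ : ℂ) • cubic (ψ₀ + w) = μ • (ψ₀ + w).fn ∧ coeffL ψ₀ w = 0

theorem IsConjugation.exists_branch (hc : IsConjugation V E W M A)
    (hV : MemLp (fun x => (V x : ℂ)) ∞ (volume : Measure Plane))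
    (hnorm : ‖ψ₀.fn‖ = 1) (h₀ : schrodinger V E ψ₀ = 0)
    (hker : ∀ φ, schrodinger V E φ = 0 → ∃ c : ℂ, φ = c • ψ₀) (γ : ℝ) :
    ∃ (k : ℝ → H2) (μ : ℝ → ℂ), ContDiffAt ℝ 1 k 0 ∧ ContDiffAt ℝ 1 μ 0 ∧ k 0 = 0 ∧ μ 0 = 0 ∧
      (∀ᶠ t in 𝓝 (0 : ℝ), BranchEq V γ E ψ₀ t (M (k t)) (μ t)) ∧
      ∀ᶠ q : ℝ × H2 × ℂ in 𝓝 0, BranchEq V γ E ψ₀ q.1 (M q.2.1) q.2.2 →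
        k q.1 = q.2.1 ∧ μ q.1 = q.2.2 := by
  obtain ⟨v, hv, hAv⟩ := hc.exists_kernel hV hnorm h₀ hker
  have hN : ContDiff ℝ 1 fun u => (γ : ℂ) • mulFn (fun x => (W x : ℂ))
      (mulFn (fun x => (W x : ℂ)) (cubic u)) := by
    have h1 : ContDiff ℝ 1 fun f => ((γ : ℂ) • (mulFn (fun x => (W x : ℂ)) ∘L
      mulFn (fun x => (W x : ℂ)))) f := (ContinuousLinearMap.contDiff _).restrict_scalars ℝ
    exact h1.comp contDiff_cubic
  obtain ⟨k, μ, hk, hμ, hk0, hμ0, hsol, huniq⟩ := NLSCenterManifold.exists_branch A fnL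
    (coeffL ψ₀ ∘L M) hN v (hc.bijective_bordered hV hnorm h₀ hker hv)
  -- The branch equation for w = M x is W times the abstract equation around v, because ψ₀ + M x =
  -- M(v + x), and multiplication by W is injective.
  have key : ∀ t : ℝ, ∀ x : H2, ∀ c : ℂ, (A x + t • (γ : ℂ) • mulFn (fun x => (W x : ℂ))
      (mulFn (fun x => (W x : ℂ)) (cubic (v + x))) = c • fnL (v + x) ∧ (coeffL ψ₀ ∘L M) x = 0) ↔
      BranchEq V γ E ψ₀ t (M x) c := by
    intro t x c
    have h1 : ψ₀ + M x = M (v + x) := by rw [map_add, hv]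
    have h2 : (M (v + x)).fn = mulFn (fun x => (W x : ℂ)) (v + x).fn := hc.fn_apply _
    rw [BranchEq, h1, cubic_eq_mulFn hc.memLp h2, hc.schrodinger_apply, h2,
      ← map_smul (mulFn (fun x => (W x : ℂ))) c]
    have h3 : t • (γ : ℂ) • mulFn (fun x => (W x : ℂ)) (mulFn (fun x => (W x : ℂ))
        (mulFn (fun x => (W x : ℂ)) (cubic (v + x)))) =
        mulFn (fun x => (W x : ℂ)) (t • (γ : ℂ) • mulFn (fun x => (W x : ℂ))
        (mulFn (fun x => (W x : ℂ)) (cubic (v + x)))) := by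
      rw [clm_map_real_smul, map_smul]
    rw [h3, ← map_add, (mulFn_ofReal_injective hc.memLp hc.pos).eq_iff]
    rfl
  refine ⟨k, μ, hk, hμ, hk0, hμ0, ?_, ?_⟩
  · filter_upwards [hsol] with t ht
    exact (key _ _ _).1 ht
  · filter_upwards [huniq] with q hq h
    exact hq ((key _ _ _).2 h).1 ((key _ _ _).2 h).2

/-- The branch of nonlinear bound states, in the weighted space. -/
theorem exists_weighted_branch (hV : MemLp (fun x => (V x : ℂ)) ∞ (volume : Measure Plane))
    (hV2 : MemLp (fun x => (V x : ℂ)) 2 (volume : Measure Plane)) (hE : E < 0)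
    (hnorm : ‖ψ₀.fn‖ = 1) (h₀ : schrodinger V E ψ₀ = 0)
    (hker : ∀ φ, schrodinger V E φ = 0 → ∃ c : ℂ, φ = c • ψ₀) (γ σ : ℝ) :
    ∃ (w : ℝ → WeightedH2 σ) (μ : ℝ → ℂ), ContDiffAt ℝ 1 w 0 ∧ ContDiffAt ℝ 1 μ 0 ∧
      w 0 = 0 ∧ μ 0 = 0 ∧ (∀ᶠ t in 𝓝 (0 : ℝ), BranchEq V γ E ψ₀ t (w t).toH2 (μ t)) ∧
      ∀ᶠ q : ℝ × H2 × ℂ in 𝓝 0, BranchEq V γ E ψ₀ q.1 q.2.1 q.2.2 →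
        (w q.1).toH2 = q.2.1 ∧ μ q.1 = q.2.2 := by
  obtain ⟨W, M, A, Mσ, hc, hMσ⟩ := exists_isConjugation hV hV2 hE σ
  obtain ⟨k, μ, hk, hμ, hk0, hμ0, hsol, -⟩ := hc.exists_branch hV hnorm h₀ hker γ
  -- The weighted branch supplies decay, while the trivial weight supplies uniqueness among all
  -- small H² functions, with no decay assumed.
  obtain ⟨k', μ', -, -, -, -, -, huniq⟩ :=
    (isConjugation_id hV hV2 hE).exists_branch hV hnorm h₀ hker γ
  have hw : ContDiffAt ℝ 1 (fun t => Mσ (k t)) 0 :=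
    ContDiffAt.clm_complex_apply (Y := WeightedH2 σ) hk Mσ
  refine ⟨fun t => Mσ (k t), μ, hw, hμ, by simp [hk0], hμ0, ?_, ?_⟩
  · filter_upwards [hsol] with t ht
    rwa [hMσ]
  · have ht : Tendsto (fun t => (t, M (k t), μ t)) (𝓝 (0 : ℝ)) (𝓝 0) := by
      have : ContinuousAt (fun t => (t, M (k t), μ t)) (0 : ℝ) :=
        continuousAt_id.prodMk ((M.continuous.continuousAt.comp hk.continuousAt).prodMk
          hμ.continuousAt)
      have h := this.tendsto
      simp only [hk0, hμ0, map_zero] at h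
      exact h
    have h1 : Tendsto (fun q : ℝ × H2 × ℂ => q.1) (𝓝 0) (𝓝 0) := continuous_fst.tendsto _
    filter_upwards [huniq, h1.eventually (ht.eventually huniq), h1.eventually hsol]
      with q hq hq1 hq2 hb
    obtain ⟨e1, e2⟩ := hq hb
    obtain ⟨e3, e4⟩ := hq1 hq2
    exact ⟨(hMσ _).trans (e3.symm.trans e1), e4.symm.trans e2⟩

end Eigenvector


/-- Continuity of g at 0 already gives f'(0) = g(0) > 0, and strict differentiability turns this
into increments of at least (g(0)/2)(y - x) near 0. -/
theorem _root_.ContDiffAt.eventually_strictMonoOn {f g : ℝ → ℝ} (hf : ContDiffAt ℝ 1 f 0)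
    (hg : ContinuousAt g 0) (hfg : ∀ᶠ t in 𝓝 0, f t = t * g t) (hg0 : 0 < g 0) :
    ∀ᶠ r in 𝓝[>] (0 : ℝ), StrictMonoOn f (Set.Ioo (-r) r) := by
  have hs := hf.hasStrictDerivAt one_ne_zero
  have h0 : f 0 = 0 := by simpa using hfg.self_of_nhds
  have hd : deriv f 0 = g 0 := by
    refine HasDerivAt.deriv (hasDerivAt_iff_tendsto_slope.2 ?_)
    refine (hg.tendsto.mono_left nhdsWithin_le_nhds).congr' ?_
    filter_upwards [nhdsWithin_le_nhds hfg, self_mem_nhdsWithin] with t ht ht0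
    rw [slope_def_field, ht, h0, sub_zero, sub_zero, mul_div_cancel_left₀ _ ht0]
  rw [hd] at hs
  have h1 := hs.isLittleO.def (half_pos hg0)
  rw [nhds_prod_eq, Metric.nhds_basis_ball.prod_self.eventually_iff] at h1
  obtain ⟨r, hr, h⟩ := h1
  filter_upwards [Ioo_mem_nhdsGT hr] with s hs x hx y hy hxy
  have hx' : x ∈ Metric.ball (0 : ℝ) r := by
    rw [Metric.mem_ball, dist_zero_right, Real.norm_eq_abs, abs_lt]
    constructor <;> linarith [hx.1, hx.2, hs.2]
  have hy' : y ∈ Metric.ball (0 : ℝ) r := by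
    rw [Metric.mem_ball, dist_zero_right, Real.norm_eq_abs, abs_lt]
    constructor <;> linarith [hy.1, hy.2, hs.2]
  have h2 := h (Set.mk_mem_prod hy' hx')
  have hyx : 0 < y - x := sub_pos.2 hxy
  simp only [ContinuousLinearMap.toSpanSingleton_apply, smul_eq_mul, Real.norm_eq_abs,
    abs_of_pos hyx] at h2
  have h3 := (abs_le.1 h2).1
  have := mul_pos hyx hg0
  linarith

theorem _root_.ContDiffAt.smul_comp_norm_sq {X : Type*} [NormedAddCommGroup X] [NormedSpace ℂ X]
    [NormedSpace ℝ X] [IsScalarTower ℝ ℂ X] {n : WithTop ℕ∞} {w : ℝ → X} {a : ℂ}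
    (hw : ContDiffAt ℝ n w (‖a‖ ^ 2)) : ContDiffAt ℝ n (fun a : ℂ => a • w (‖a‖ ^ 2)) a :=
  contDiffAt_id.smul (hw.comp a (contDiff_norm_sq ℝ).contDiffAt)

theorem norm_fn_le (u : H2) : ‖u.fn‖ ≤ ‖u‖ := norm_fst_le u.1

/-! ### Energy shift, reduction by scaling, and localisation of small solutions -/

section Branch

variable {V : Plane → ℝ} {E : ℝ} {ψ₀ : H2}

theorem norm_coeffL_le (hnorm : ‖ψ₀.fn‖ = 1) (u : H2) : ‖coeffL ψ₀ u‖ ≤ ‖u‖ := by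
  rw [coeffL_apply]
  refine (norm_inner_le_norm _ _).trans ?_
  rw [hnorm, one_mul]
  exact norm_fn_le u

theorem BranchEq.eq_inner (hV : MemLp (fun x => (V x : ℂ)) ∞ (volume : Measure Plane))
    (hnorm : ‖ψ₀.fn‖ = 1) (h₀ : schrodinger V E ψ₀ = 0) {γ t : ℝ} {w : H2} {μ : ℂ}
    (h : BranchEq V γ E ψ₀ t w μ) :
    μ = t * γ * inner ℂ ψ₀.fn (cubic (ψ₀ + w)) := by
  obtain ⟨h1, h2⟩ := h
  have h3 := congrArg (fun f => inner ℂ ψ₀.fn f) h1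
  have h4 : inner ℂ ψ₀.fn (ψ₀ + w).fn = (1 : ℂ) := by
    rw [← coeffL_apply, map_add, h2, coeffL_self hnorm, add_zero]
  have h5 : t • (γ : ℂ) • cubic (ψ₀ + w) = ((t : ℂ) * γ) • cubic (ψ₀ + w) := by
    rw [← smul_assoc, Complex.real_smul]
  rw [h5, inner_add_right, inner_smul_right, inner_smul_right, inner_schrodinger_eq_zero hV h₀, h4,
    zero_add, mul_one] at h3
  exact h3.symm

/-- The implicit function theorem yields a complex μ. Pairing the equation with ψ₀ + w, which is
nonzero as its ψ₀-coefficient is 1, leaves only real quantities next to μ. -/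
theorem BranchEq.im_eq_zero (hV : MemLp (fun x => (V x : ℂ)) ∞ (volume : Measure Plane))
    (hnorm : ‖ψ₀.fn‖ = 1) (h₀ : schrodinger V E ψ₀ = 0) {γ t : ℝ} {w : H2} {μ : ℂ}
    (h : BranchEq V γ E ψ₀ t w μ) : μ.im = 0 := by
  obtain ⟨h1, h2⟩ := h
  have h3 := congrArg (fun f => inner ℂ (ψ₀ + w).fn f) h1
  have h4 : inner ℂ ψ₀.fn (ψ₀ + w).fn = (1 : ℂ) := by
    rw [← coeffL_apply, map_add, h2, coeffL_self hnorm, add_zero]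
  have h5 : t • (γ : ℂ) • cubic (ψ₀ + w) = ((t : ℂ) * γ) • cubic (ψ₀ + w) := by
    rw [← smul_assoc, Complex.real_smul]
  have h6 : schrodinger V E w = schrodinger V E (ψ₀ + w) := by rw [map_add, h₀, zero_add]
  have h7 : (inner ℂ (ψ₀ + w).fn (schrodinger V E (ψ₀ + w)) : ℂ).im = 0 := by
    rw [← Complex.conj_eq_iff_im, inner_conj_symm, inner_schrodinger hV]
  have h8 : (ψ₀ + w).fn ≠ 0 := by
    intro h
    rw [h, inner_zero_right] at h4
    exact zero_ne_one h4
  rw [h5, h6, inner_add_right, inner_smul_right, inner_smul_right, inner_cubic,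
    inner_self_eq_norm_sq_to_K] at h3
  have h9 := congrArg Complex.im h3
  rw [Complex.add_im, h7] at h9
  have h10 : ((t : ℂ) * γ * ((‖absSq (ψ₀ + w)‖ ^ 2 : ℝ) : ℂ)).im = 0 := by
    rw [← Complex.ofReal_mul, ← Complex.ofReal_mul, Complex.ofReal_im]
  have h11 : (μ * ((‖(ψ₀ + w).fn‖ : ℂ)) ^ 2).im = μ.im * ‖(ψ₀ + w).fn‖ ^ 2 := by
    rw [← Complex.ofReal_pow, Complex.im_mul_ofReal]
  have h12 : μ.im * ‖(ψ₀ + w).fn‖ ^ 2 = 0 := by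
    rw [← h11]
    refine h9.symm.trans ?_
    rw [h10, add_zero]
  exact (mul_eq_zero.1 h12).resolve_right (pow_ne_zero 2 (norm_ne_zero_iff.2 h8))

theorem solvesNLS_smul_iff (hV : MemLp (fun x => (V x : ℂ)) ∞ (volume : Measure Plane))
    (h₀ : schrodinger V E ψ₀ = 0) {γ : ℝ} (E' : ℝ) {w : H2} (hw : coeffL ψ₀ w = 0)
    {a : ℂ} (ha : a ≠ 0) :
    SolvesNLS V γ E' (a • (ψ₀ + w)) ↔
      BranchEq V γ E ψ₀ (‖a‖ ^ 2) w ((E' - E : ℝ) : ℂ) := by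
  have h1 : (a • (ψ₀ + w)).fn = a • (ψ₀ + w).fn := rfl
  have h2 : schrodinger V E (a • (ψ₀ + w)) = a • schrodinger V E w := by
    rw [map_smul, map_add, h₀, zero_add]
  have h3 : (γ : ℂ) • (((‖a‖ ^ 2 : ℝ) : ℂ) * a) • cubic (ψ₀ + w) =
      a • (‖a‖ ^ 2) • (γ : ℂ) • cubic (ψ₀ + w) := by
    have : (‖a‖ ^ 2) • (γ : ℂ) • cubic (ψ₀ + w) =
        (((‖a‖ ^ 2 : ℝ) : ℂ) * γ) • cubic (ψ₀ + w) := by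
      rw [← smul_assoc, Complex.real_smul]
    rw [this, smul_smul, smul_smul]
    congr 1
    ring
  rw [solvesNLS_iff hV γ E, BranchEq, cubic_smul, h1, h2, h3, ← smul_add,
    smul_comm ((E' - E : ℝ) : ℂ) a, (smul_right_injective L2 ha).eq_iff]
  exact ⟨fun h => ⟨h, hw⟩, fun h => h.1⟩

/-- Boundedness of the bordered inverse. The constant does not depend on c, so the ψ₀-component of
the right-hand side need not be controlled. -/
theorem exists_bordered_bound (hV : MemLp (fun x => (V x : ℂ)) ∞ (volume : Measure Plane))
    (hV2 : MemLp (fun x => (V x : ℂ)) 2 (volume : Measure Plane)) (hE : E < 0)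
    (hnorm : ‖ψ₀.fn‖ = 1) (h₀ : schrodinger V E ψ₀ = 0)
    (hker : ∀ φ, schrodinger V E φ = 0 → ∃ c : ℂ, φ = c • ψ₀) :
    ∃ C > 0, ∀ (u : H2) (c : ℂ), coeffL ψ₀ u = 0 → ‖u‖ ≤ C * ‖schrodinger V E u - c • ψ₀.fn‖ := by
  have hb := (isConjugation_id hV hV2 hE).bijective_bordered hV hnorm h₀ hker (v := ψ₀) rfl
  let L : H2 × ℂ →L[ℂ] L2 × ℂ :=
    (schrodinger V E ∘L .fst ℂ H2 ℂ - (ContinuousLinearMap.snd ℂ H2 ℂ).smulRight ψ₀.fn).prod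
      (coeffL ψ₀ ∘L .fst ℂ H2 ℂ)
  have hL : Function.Bijective L := hb
  let e := ContinuousLinearEquiv.ofBijective L (LinearMap.ker_eq_bot.2 hL.1)
    (LinearMap.range_eq_top.2 hL.2)
  refine ⟨‖(e.symm : L2 × ℂ →L[ℂ] H2 × ℂ)‖ + 1, by positivity, fun u c hu => ?_⟩
  have h1 : e (u, c) = (schrodinger V E u - c • ψ₀.fn, 0) := Prod.ext rfl hu
  have h2 : (u, c) = e.symm (schrodinger V E u - c • ψ₀.fn, 0) := by
    rw [← h1, e.symm_apply_apply]
  calc ‖u‖ ≤ ‖(u, c)‖ := norm_fst_le (u, c)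
    _ ≤ ‖(e.symm : L2 × ℂ →L[ℂ] H2 × ℂ)‖ * ‖(schrodinger V E u - c • ψ₀.fn, (0 : ℂ))‖ := by
      rw [h2]
      exact (e.symm : L2 × ℂ →L[ℂ] H2 × ℂ).le_opNorm _
    _ ≤ _ := by
      rw [Prod.norm_def, norm_zero, max_eq_left (norm_nonneg _)]
      gcongr
      linarith

/-- Small solutions are close to the eigenspace. -/
theorem exists_small_solution_bound
    (hV : MemLp (fun x => (V x : ℂ)) ∞ (volume : Measure Plane))
    (hV2 : MemLp (fun x => (V x : ℂ)) 2 (volume : Measure Plane)) (hE : E < 0)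
    (hnorm : ‖ψ₀.fn‖ = 1) (h₀ : schrodinger V E ψ₀ = 0)
    (hker : ∀ φ, schrodinger V E φ = 0 → ∃ c : ℂ, φ = c • ψ₀) (γ : ℝ) :
    ∃ ε > 0, ∃ D ≥ 0, ∀ (ψ : H2) (E' : ℝ), ψ ≠ 0 → ‖ψ‖ < ε → |E' - E| < ε →
      SolvesNLS V γ E' ψ → coeffL ψ₀ ψ ≠ 0 ∧ ‖(coeffL ψ₀ ψ)⁻¹ • ψ - ψ₀‖ ≤ D * ‖ψ‖ ^ 2 := by
  obtain ⟨C, hC, hb⟩ := exists_bordered_bound hV hV2 hE hnorm h₀ hker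
  obtain ⟨N, hN, hcub⟩ := exists_norm_cubic_le
  set D := 2 * C * |γ| * N with hD
  have hD0 : 0 ≤ D := by positivity
  -- The first smallness absorbs μu into the left side of the estimate for u; the second makes ‖u‖
  -- at most half of ‖ψ‖.
  obtain ⟨ε, hε, hε1, hε2⟩ : ∃ ε > 0, C * ε ≤ 1 / 2 ∧ D * ε ^ 2 ≤ 1 / 2 := by
    have h1 : Tendsto (fun ε : ℝ => C * ε) (𝓝[>] 0) (𝓝 0) := by
      have : Continuous fun ε : ℝ => C * ε := by fun_prop
      exact (this.tendsto' 0 0 (by simp)).mono_left nhdsWithin_le_nhds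
    have h2 : Tendsto (fun ε : ℝ => D * ε ^ 2) (𝓝[>] 0) (𝓝 0) := by
      have : Continuous fun ε : ℝ => D * ε ^ 2 := by fun_prop
      exact (this.tendsto' 0 0 (by simp)).mono_left nhdsWithin_le_nhds
    have h3 := (h1.eventually (ge_mem_nhds (half_pos one_pos))).and
      (h2.eventually (ge_mem_nhds (half_pos one_pos)))
    obtain ⟨ε, h, hε⟩ := (h3.and self_mem_nhdsWithin).exists
    exact ⟨ε, hε, h⟩
  refine ⟨ε, hε, 2 * D * ‖ψ₀‖, by positivity, fun ψ E' hψ0 hψε hEε hψ => ?_⟩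
  rw [solvesNLS_iff hV γ E] at hψ
  set a := coeffL ψ₀ ψ with ha
  set μ : ℂ := ((E' - E : ℝ) : ℂ) with hμ
  have hμn : ‖μ‖ < ε := by rwa [hμ, Complex.norm_real]
  set u : H2 := ψ - a • ψ₀ with hu
  have hu0 : coeffL ψ₀ u = 0 := by
    rw [hu, map_sub, map_smul, coeffL_self hnorm, smul_eq_mul, mul_one, ← ha, sub_self]
  -- The linear term μψ splits as μu + μaψ₀. The second piece, only of first order in a, is taken up
  -- by the free scalar of the bordered bound.
  have hTu : schrodinger V E u - (μ * a) • ψ₀.fn = μ • u.fn - (γ : ℂ) • cubic ψ := by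
    have h1 : schrodinger V E u = schrodinger V E ψ := by
      rw [hu, map_sub, map_smul, h₀, smul_zero, sub_zero]
    have h2 : u.fn = ψ.fn - a • ψ₀.fn := rfl
    rw [h1, h2, smul_sub, smul_smul, ← hψ]
    abel
  have hun : ‖u‖ ≤ D * ‖ψ‖ ^ 3 := by
    have h1 := hb u (μ * a) hu0
    rw [hTu] at h1
    have h2 : ‖μ • u.fn - (γ : ℂ) • cubic ψ‖ ≤ ε * ‖u‖ + |γ| * (N * ‖ψ‖ ^ 3) := by
      refine (norm_sub_le _ _).trans ?_
      rw [norm_smul, norm_smul]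
      gcongr
      · exact norm_fn_le u
      · rw [Complex.norm_real, Real.norm_eq_abs]
      · exact hcub ψ
    have h3 : ‖u‖ ≤ C * ε * ‖u‖ + D / 2 * ‖ψ‖ ^ 3 :=
      (h1.trans (mul_le_mul_of_nonneg_left h2 hC.le)).trans_eq (by rw [hD]; ring)
    have h4 := mul_le_mul_of_nonneg_right hε1 (norm_nonneg u)
    linarith
  -- This comparison of ‖ψ‖ with |a| shows a ≠ 0, and it is the source of the factor 2‖ψ₀‖ in the
  -- final constant.
  have hψn : ‖ψ‖ ≤ 2 * (‖a‖ * ‖ψ₀‖) := by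
    have h1 : ‖ψ‖ ≤ ‖u‖ + ‖a‖ * ‖ψ₀‖ := by
      rw [← norm_smul]
      calc ‖ψ‖ = ‖u + a • ψ₀‖ := by rw [hu, sub_add_cancel]
        _ ≤ _ := norm_add_le _ _
    have h2 : D * ‖ψ‖ ^ 3 ≤ 1 / 2 * ‖ψ‖ := by
      calc D * ‖ψ‖ ^ 3 = D * ‖ψ‖ ^ 2 * ‖ψ‖ := by ring
        _ ≤ D * ε ^ 2 * ‖ψ‖ := by gcongr
        _ ≤ _ := by gcongr
    linarith
  have ha0 : a ≠ 0 := by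
    intro h
    rw [h, norm_zero, zero_mul, mul_zero] at hψn
    exact hψ0 (norm_le_zero_iff.1 hψn)
  refine ⟨ha0, ?_⟩
  have h1 : a⁻¹ • ψ - ψ₀ = a⁻¹ • u := by
    rw [hu, smul_sub, smul_smul, inv_mul_cancel₀ ha0, one_smul]
  rw [h1, norm_smul, norm_inv, inv_mul_le_iff₀ (norm_pos_iff.2 ha0)]
  calc ‖u‖ ≤ D * ‖ψ‖ ^ 2 * ‖ψ‖ := hun.trans_eq (by ring)
    _ ≤ D * ‖ψ‖ ^ 2 * (2 * (‖a‖ * ‖ψ₀‖)) := by gcongr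
    _ = _ := by ring

end Branch


/-! ### Monotone branch, capture of small solutions, decay of the potential, phases -/

theorem continuous_toH2 {σ : ℝ} : Continuous (WeightedH2.toH2 (σ := σ)) :=
  continuous_fst.comp continuous_subtype_val

theorem continuous_inner_cubic (ψ₀ : H2) :
    Continuous fun w : H2 => (inner ℂ ψ₀.fn (cubic (ψ₀ + w)) : ℂ) := by
  have h1 : Continuous cubic := (contDiff_cubic (n := 0)).continuous
  have h2 : Continuous fun w : H2 => cubic (ψ₀ + w) := h1.comp (continuous_const.add continuous_id)
  exact (innerSL ℂ ψ₀.fn).continuous.comp h2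

theorem eventually_norm_smul_lt {X : Type*} [NormedAddCommGroup X] [NormedSpace ℂ X] {g : ℝ → X}
    (hg : ContinuousAt g 0) {ε : ℝ} (hε : 0 < ε) : ∀ᶠ a : ℂ in 𝓝 0, ‖a • g (‖a‖ ^ 2)‖ < ε := by
  have h1 : Tendsto (fun a : ℂ => ‖a‖ ^ 2) (𝓝 0) (𝓝 0) := by
    have : Continuous fun a : ℂ => ‖a‖ ^ 2 := by fun_prop
    exact this.tendsto' 0 0 (by simp)
  have h3 : Tendsto (fun a : ℂ => ‖a • g (‖a‖ ^ 2)‖) (𝓝 0) (𝓝 ‖(0 : ℂ) • g 0‖) :=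
    (tendsto_id.smul (hg.tendsto.comp h1)).norm
  rw [zero_smul, norm_zero] at h3
  exact h3.eventually (gt_mem_nhds hε)

theorem phase_smul_comp_norm_sq {X : Type*} [NormedAddCommGroup X] [NormedSpace ℂ X] (g : ℝ → X)
    (θ : ℝ) (a : ℂ) : (Complex.exp (θ * Complex.I) * a) • g (‖Complex.exp (θ * Complex.I) * a‖ ^ 2) =
      Complex.exp (θ * Complex.I) • a • g (‖a‖ ^ 2) := by
  rw [norm_mul, Complex.norm_exp_ofReal_mul_I, one_mul, mul_smul]

section Branch

variable {V : Plane → ℝ} {E : ℝ} {ψ₀ : H2}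

/-- The branch of nonlinear bound states with a real, monotone energy shift `f t / γ`. -/
theorem exists_monotone_branch (hV : MemLp (fun x => (V x : ℂ)) ∞ (volume : Measure Plane))
    (hV2 : MemLp (fun x => (V x : ℂ)) 2 (volume : Measure Plane)) (hE : E < 0)
    (hnorm : ‖ψ₀.fn‖ = 1) (h₀ : schrodinger V E ψ₀ = 0)
    (hker : ∀ φ, schrodinger V E φ = 0 → ∃ c : ℂ, φ = c • ψ₀) {γ : ℝ} (hγ : γ ≠ 0) (σ : ℝ) :
    ∃ (w : ℝ → WeightedH2 σ) (f : ℝ → ℝ), ∃ r > 0, w 0 = 0 ∧ f 0 = 0 ∧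
      (∀ t ∈ Set.Ioo (-r) r, ContDiffAt ℝ 1 w t) ∧
      (∀ t ∈ Set.Ioo (-r) r, ContinuousAt f t) ∧ StrictMonoOn f (Set.Ioo (-r) r) ∧
      (∀ t ∈ Set.Ioo (-r) r, BranchEq V γ E ψ₀ t (w t).toH2 ((f t / γ : ℝ) : ℂ)) ∧
      ∀ t ∈ Set.Ioo (-r) r, ∀ (u : H2) (μ : ℝ), ‖u‖ < r → |μ| < r → BranchEq V γ E ψ₀ t u μ →
        (w t).toH2 = u ∧ f t = γ * μ := by
  obtain ⟨w, μ, hw, hμ, hw0, hμ0, hsol, huniq⟩ :=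
    exists_weighted_branch hV hV2 hE hnorm h₀ hker γ σ
  have hψ₀ : ψ₀ ≠ 0 := by
    rintro rfl
    exact zero_ne_one ((norm_zero (E := L2)).symm.trans hnorm)
  have hw0' : (w 0).toH2 = 0 := by rw [hw0]; rfl
  set g : ℝ → ℝ := fun t => γ ^ 2 * (inner ℂ ψ₀.fn (cubic (ψ₀ + (w t).toH2)) : ℂ).re with hg
  -- The factor γ in f makes it increasing whatever the sign of γ.
  set f : ℝ → ℝ := fun t => γ * (μ t).re with hf
  have hfc : ContDiffAt ℝ 1 f 0 := by
    have h1 : ContDiffAt ℝ 1 (fun t => Complex.reCLM (μ t)) 0 :=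
      Complex.reCLM.contDiff.contDiffAt.comp 0 hμ
    exact contDiffAt_const.mul h1
  have hgc : ContinuousAt g 0 := by
    have h1 : ContinuousAt (fun t => (w t).toH2) 0 :=
      continuous_toH2.continuousAt.comp hw.continuousAt
    have h2 : ContinuousAt (fun t => (inner ℂ ψ₀.fn (cubic (ψ₀ + (w t).toH2)) : ℂ)) 0 :=
      (continuous_inner_cubic ψ₀).continuousAt.comp h1
    exact continuousAt_const.mul (Complex.continuous_re.continuousAt.comp h2)
  have hfg : ∀ᶠ t in 𝓝 0, f t = t * g t := by
    filter_upwards [hsol] with t ht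
    have h1 := ht.eq_inner hV hnorm h₀
    simp only [hf, hg]
    rw [h1, ← Complex.ofReal_mul, Complex.re_ofReal_mul]
    ring
  have hg0 : 0 < g 0 := by
    have h1 : 0 < ‖absSq ψ₀‖ := norm_pos_iff.2 (absSq_ne_zero hψ₀)
    simp only [hg]
    rw [hw0', add_zero, inner_cubic, Complex.ofReal_re]
    positivity
  have hsolf : ∀ᶠ t in 𝓝 (0 : ℝ), BranchEq V γ E ψ₀ t (w t).toH2 ((f t / γ : ℝ) : ℂ) := by
    filter_upwards [hsol] with t ht
    have h1 : ((f t / γ : ℝ) : ℂ) = μ t := by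
      simp only [hf]
      rw [mul_div_cancel_left₀ _ hγ]
      apply Complex.ext
      · simp
      · rw [ht.im_eq_zero hV hnorm h₀, Complex.ofReal_im]
    rwa [h1]
  obtain ⟨r₁, hr₁, h₁⟩ := Metric.eventually_nhds_iff.1 ((hw.eventually (by simp)).and
    (((hfc.eventually (by simp)).mono fun _ h => h.continuousAt).and hsolf))
  obtain ⟨r₂, hr₂, h₂⟩ := Metric.eventually_nhds_iff.1 huniq
  obtain ⟨r, hmono, hr, hr12⟩ :=
    ((hfc.eventually_strictMonoOn hgc hfg hg0).and (Ioo_mem_nhdsGT (lt_min hr₁ hr₂))).exists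
  have habs : ∀ t ∈ Set.Ioo (-r) r, ∀ s, r < s → |t| < s := fun t ht s hs => by
    rw [abs_lt]
    constructor <;> linarith [ht.1, ht.2]
  have h₁' : ∀ t ∈ Set.Ioo (-r) r, _ := fun t ht => @h₁ t (by
    rw [dist_zero_right, Real.norm_eq_abs]
    exact habs t ht _ (hr12.trans_le (min_le_left _ _)))
  have hr2 := hr12.trans_le (min_le_right _ _)
  refine ⟨w, f, r, hr, hw0, by simp [hf, hμ0], fun t ht => (h₁' t ht).1, fun t ht => (h₁' t ht).2.1,
    hmono, fun t ht => (h₁' t ht).2.2, fun t ht u ν hu hν hb => ?_⟩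
  have h3 : dist (t, u, (ν : ℂ)) (0 : ℝ × H2 × ℂ) < r₂ := by
    rw [dist_zero_right, Prod.norm_def, Prod.norm_def, max_lt_iff, max_lt_iff]
    refine ⟨habs t ht _ hr2, hu.trans hr2, ?_⟩
    simpa using hν.trans hr2
  obtain ⟨h4, h5⟩ := h₂ h3 hb
  refine ⟨h4, ?_⟩
  simp only at h5
  simp only [hf, h5, Complex.ofReal_re]

/-- Every small solution lies on the branch, up to a constant factor. -/
theorem exists_forall_small_solution
    (hV : MemLp (fun x => (V x : ℂ)) ∞ (volume : Measure Plane))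
    (hV2 : MemLp (fun x => (V x : ℂ)) 2 (volume : Measure Plane)) (hE : E < 0)
    (hnorm : ‖ψ₀.fn‖ = 1) (h₀ : schrodinger V E ψ₀ = 0)
    (hker : ∀ φ, schrodinger V E φ = 0 → ∃ c : ℂ, φ = c • ψ₀) {γ : ℝ} {w : ℝ → H2} {f : ℝ → ℝ}
    {r : ℝ} (hr : 0 < r)
    (huniq : ∀ t ∈ Set.Ioo (-r) r, ∀ (u : H2) (μ : ℝ), ‖u‖ < r → |μ| < r →
      BranchEq V γ E ψ₀ t u μ → w t = u ∧ f t = γ * μ) :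
    ∃ ε > 0, ∃ η > 0, ∀ (ψ : H2) (E' : ℝ), ψ ≠ 0 → ‖ψ‖ < ε → |E' - E| < η → SolvesNLS V γ E' ψ →
      ∃ a : ℂ, a ≠ 0 ∧ ‖a‖ ^ 2 < r ∧ ψ = a • (ψ₀ + w (‖a‖ ^ 2)) ∧
        f (‖a‖ ^ 2) = γ * (E' - E) := by
  obtain ⟨η, hη, D, hD, hsmall⟩ := exists_small_solution_bound hV hV2 hE hnorm h₀ hker γ
  -- D + 1 handles two requirements together: |a|² ≤ ε² < r and ‖a⁻¹ψ - ψ₀‖ ≤ Dε² < r.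
  have h1 : ∀ᶠ ε in 𝓝[>] (0 : ℝ), (D + 1) * ε ^ 2 < r := by
    have : Continuous fun ε : ℝ => (D + 1) * ε ^ 2 := by fun_prop
    exact nhdsWithin_le_nhds ((this.tendsto' 0 0 (by simp)).eventually (gt_mem_nhds hr))
  obtain ⟨ε, hεr, hε, hεη⟩ := (h1.and (Ioo_mem_nhdsGT hη)).exists
  refine ⟨ε, hε, min η r, lt_min hη hr, fun ψ E' hψ0 hψε hE' hψ => ?_⟩
  obtain ⟨ha, hbd⟩ := hsmall ψ E' hψ0 (hψε.trans hεη) (hE'.trans_le (min_le_left _ _)) hψ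
  set a := coeffL ψ₀ ψ with hadef
  have hψ2 : ‖ψ‖ ^ 2 ≤ ε ^ 2 := by gcongr
  have hε2 : 0 ≤ ε ^ 2 := sq_nonneg ε
  have har : ‖a‖ ^ 2 < r := by
    have h2 : ‖a‖ ≤ ‖ψ‖ := norm_coeffL_le hnorm ψ
    have h3 : ‖a‖ ^ 2 ≤ ‖ψ‖ ^ 2 := by gcongr
    nlinarith
  set u := a⁻¹ • ψ - ψ₀ with hu
  have hur : ‖u‖ < r := by nlinarith
  have hψu : ψ = a • (ψ₀ + u) := by
    rw [hu, add_sub_cancel, smul_smul, mul_inv_cancel₀ ha, one_smul]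
  have hu0 : coeffL ψ₀ u = 0 := by
    rw [hu, map_sub, map_smul, coeffL_self hnorm, ← hadef, smul_eq_mul, inv_mul_cancel₀ ha,
      sub_self]
  rw [hψu, solvesNLS_smul_iff hV h₀ E' hu0 ha] at hψ
  obtain ⟨h2, h3⟩ := huniq _ ⟨by linarith [sq_nonneg ‖a‖], har⟩ u _ hur
    (hE'.trans_le (min_le_right _ _)) hψ
  exact ⟨a, ha, har, by rw [h2]; exact hψu, h3⟩

theorem solvesNLS_zero (hV : MemLp (fun x => (V x : ℂ)) ∞ (volume : Measure Plane)) (γ E' : ℝ) :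
    SolvesNLS V γ E' 0 := by
  have h1 : cubic 0 = 0 := by
    have := cubic_smul 0 0
    rwa [zero_smul, norm_zero, mul_zero, zero_smul] at this
  have h2 : (0 : H2).fn = 0 := rfl
  rw [solvesNLS_iff hV γ 0, map_zero, h1, h2, smul_zero, smul_zero, add_zero]

theorem memLp_potential (hVmeas : Measurable V)
    (hVdecay : ∃ C > (0 : ℝ), ∃ ρ > (3 : ℝ), ∀ x, |V x| ≤ C * japanese x ^ (-ρ)) :
    MemLp (fun x => (V x : ℂ)) ∞ (volume : Measure Plane) ∧
      MemLp (fun x => (V x : ℂ)) 2 (volume : Measure Plane) := by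
  obtain ⟨C, hC, ρ, hρ, h⟩ := hVdecay
  have hm : Measurable fun x => (V x : ℂ) := Complex.measurable_ofReal.comp hVmeas
  have hle : ∀ x, japanese x ^ (-ρ) ≤ 1 := fun x => by
    rw [japanese_rpow]
    exact Real.rpow_le_one_of_one_le_of_nonpos (by nlinarith [sq_nonneg ‖x‖]) (by linarith)
  refine ⟨memLp_top_of_norm_le hm (C := C) fun x => ?_, ?_⟩
  · rw [Complex.norm_real]
    exact (h x).trans (mul_le_of_le_one_right hC.le (hle x))
  · rw [memLp_two_iff_integrable_sq_norm hm.aestronglyMeasurable]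
    -- Square integrability in the plane needs 2ρ > 2, which follows from ρ > 3.
    have hi : Integrable (fun x : Plane => C ^ 2 * (1 + ‖x‖ ^ 2) ^ (-(2 * ρ) / 2)) volume := by
      refine (integrable_rpow_neg_one_add_norm_sq ?_).const_mul _
      rw [finrank_euclideanSpace_fin]
      push_cast
      linarith
    refine hi.mono' (by fun_prop) (Eventually.of_forall fun x => ?_)
    rw [Complex.norm_real, Real.norm_of_nonneg (by positivity), Real.norm_eq_abs]
    calc |V x| ^ 2 ≤ (C * japanese x ^ (-ρ)) ^ 2 := by
          gcongr
          exact h x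
      _ = _ := by
        rw [mul_pow, japanese_rpow, ← Real.rpow_natCast ((1 + ‖x‖ ^ 2) ^ (-ρ / 2)),
          ← Real.rpow_mul (by positivity)]
        congr 2
        push_cast
        ring

theorem exists_phase {a b : ℂ} (h : ‖a‖ = ‖b‖) (hb : 0 ≤ b.re) (hb' : b.im = 0) :
    ∃ θ ∈ Set.Ico 0 (2 * Real.pi), a = Complex.exp (θ * Complex.I) * b := by
  have hbn : b = (‖a‖ : ℂ) := by
    have h1 : b = (b.re : ℂ) := Complex.ext (by simp) (by simp [hb'])
    rw [h, h1, Complex.norm_real, Real.norm_of_nonneg hb]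
  have h2 := Complex.norm_mul_exp_arg_mul_I a
  rw [hbn]
  rcases le_or_gt 0 a.arg with h0 | h0
  · refine ⟨a.arg, ⟨h0, ?_⟩, by rw [mul_comm, h2]⟩
    linarith [Complex.arg_le_pi a, Real.pi_pos]
  · refine ⟨a.arg + 2 * Real.pi, ⟨?_, by linarith⟩, ?_⟩
    · linarith [Complex.neg_pi_lt_arg a, Real.pi_pos]
    · push_cast
      rw [add_mul, Complex.exp_add, Complex.exp_two_pi_mul_I, mul_one, mul_comm, h2]

end Branch

end NLSCenterManifold
end

open Filter Topology

/-! ### Choice of the radii and proof of the theorem -/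

open NLSCenterManifold in
theorem proposition2p1
    (V : Plane → ℝ) (hVmeas : Measurable V)
    -- decay of the potential
    (hVdecay : ∃ C > (0 : ℝ), ∃ ρ > (3 : ℝ), ∀ x, |V x| ≤ C * japanese x ^ (-ρ))
    (γ : ℝ) (hγ : γ ≠ 0)
    -- `E₀` is a negative eigenvalue of `-Δ + V` with normalized eigenvector `ψ₀`
    (E₀ : ℝ) (hE₀ : E₀ < 0) (ψ₀ : H2) (hψ₀norm : ‖ψ₀.fn‖ = 1) (hψ₀ : SolvesNLS V 0 E₀ ψ₀)
    -- counted with multiplicity, there is no other negative eigenvalue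
    (hunique : ∀ E : ℝ, E < 0 → ∀ φ : H2, φ ≠ 0 → SolvesNLS V 0 E φ →
      E = E₀ ∧ ∃ c : ℂ, φ = c • ψ₀)
    (σ : ℝ) :
    ∃ δE > (0 : ℝ), ∃ δ > (0 : ℝ), ∃ ε > (0 : ℝ), ∃ h : ℂ → WeightedH2 σ,
      ContDiffOn ℝ 1 h (Metric.ball 0 δ) ∧
      h 0 = 0 ∧
      -- the points of the manifold
      (∀ a : ℂ, ‖a‖ < δ →
        inner ℂ ψ₀.fn (h a).toH2.fn = 0 ∧
        (∀ θ : ℝ, h (Complex.exp (θ * Complex.I) * a) = Complex.exp (θ * Complex.I) • h a) ∧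
        ‖a • ψ₀ + (h a).toH2‖ < ε ∧
        ∃ E : ℝ, |E - E₀| < δE ∧ SolvesNLS V γ E (a • ψ₀ + (h a).toH2)) ∧
      -- existence, and uniqueness up to a phase, on the side of `E₀` given by the sign of `γ`
      (∀ E : ℝ, |E - E₀| < δE → 0 < γ * (E - E₀) →
        ∃ a : ℂ, a ≠ 0 ∧ ‖a‖ < δ ∧ SolvesNLS V γ E (a • ψ₀ + (h a).toH2) ∧
          ∀ ψ : H2, ψ ≠ 0 → ‖ψ‖ < ε → SolvesNLS V γ E ψ →
            ∃ θ ∈ Set.Ico 0 (2 * Real.pi),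
              ψ = Complex.exp (θ * Complex.I) • (a • ψ₀ + (h a).toH2)) ∧
      -- no small nontrivial solution otherwise
      (∀ E : ℝ, |E - E₀| < δE → γ * (E - E₀) ≤ 0 →
        ∀ ψ : H2, ‖ψ‖ < ε → SolvesNLS V γ E ψ → ψ = 0) := by
  obtain ⟨hV, hV2⟩ := memLp_potential hVmeas hVdecay
  have hlin : ∀ φ, SolvesNLS V 0 E₀ φ ↔ schrodinger V E₀ φ = 0 := fun φ => by
    rw [solvesNLS_iff hV 0 E₀, sub_self]
    simp only [Complex.ofReal_zero, zero_smul, add_zero]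
  have h₀ := (hlin ψ₀).1 hψ₀
  have hker : ∀ φ, schrodinger V E₀ φ = 0 → ∃ c : ℂ, φ = c • ψ₀ := fun φ hφ => by
    by_cases hφ0 : φ = 0
    · exact ⟨0, by rw [hφ0, zero_smul]⟩
    · exact (hunique E₀ hE₀ φ hφ0 ((hlin φ).2 hφ)).2
  obtain ⟨w, f, r, hr, hw0, hf0, hw, hfc, hmono, hsol, huniq⟩ :=
    exists_monotone_branch hV hV2 hE₀ hψ₀norm h₀ hker hγ σ
  obtain ⟨ε, hε, η, hη, hloc⟩ :=
    exists_forall_small_solution hV hV2 hE₀ hψ₀norm h₀ hker hr huniq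
  have hmem0 : (0 : ℝ) ∈ Set.Ioo (-r) r := ⟨by linarith, hr⟩
  have hγ' : 0 < |γ| := abs_pos.2 hγ
  have hwc : ContinuousAt (fun t => ψ₀ + (w t).toH2) 0 :=
    continuousAt_const.add (continuous_toH2.continuousAt.comp (hw 0 hmem0).continuousAt)
  have hnorm0 := eventually_norm_smul_lt hwc hε
  obtain ⟨δ₁, hδ₁, hδ₁ε⟩ := Metric.eventually_nhds_iff.1 hnorm0
  -- δ² stays in the domain of the branch, and f(δ²) < |γ|η puts every admissible E in the range
  -- where small solutions are captured.
  have hδex : ∀ᶠ δ in 𝓝[>] (0 : ℝ), δ ^ 2 < r ∧ f (δ ^ 2) < |γ| * η := by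
    have h1 : Tendsto (fun δ : ℝ => δ ^ 2) (𝓝 0) (𝓝 0) := by
      have : Continuous fun δ : ℝ => δ ^ 2 := by fun_prop
      exact this.tendsto' 0 0 (by simp)
    have h2 : Tendsto (fun δ : ℝ => f (δ ^ 2)) (𝓝 0) (𝓝 0) := by
      have := (hfc 0 hmem0).tendsto.comp h1
      rwa [hf0] at this
    exact nhdsWithin_le_nhds ((h1.eventually (gt_mem_nhds hr)).and
      (h2.eventually (gt_mem_nhds (mul_pos hγ' hη))))
  obtain ⟨δ, ⟨hδr, hδf⟩, hδ, hδδ₁⟩ := (hδex.and (Ioo_mem_nhdsGT hδ₁)).exists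
  have hδmem : δ ^ 2 ∈ Set.Ioo (-r) r := ⟨by linarith [sq_nonneg δ], hδr⟩
  have hfδ : 0 < f (δ ^ 2) := by
    rw [← hf0]
    exact hmono hmem0 hδmem (by positivity)
  have hmem : ∀ a : ℂ, ‖a‖ < δ → ‖a‖ ^ 2 < δ ^ 2 ∧ ‖a‖ ^ 2 ∈ Set.Ioo (-r) r := fun a ha => by
    have : ‖a‖ ^ 2 < δ ^ 2 := by gcongr
    exact ⟨this, by linarith [sq_nonneg ‖a‖], this.trans hδr⟩
  have hδE : f (δ ^ 2) / |γ| < η := by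
    rw [div_lt_iff₀ hγ', mul_comm]
    exact hδf
  have hpt : ∀ a : ℂ, a • ψ₀ + (a • w (‖a‖ ^ 2)).toH2 = a • (ψ₀ + (w (‖a‖ ^ 2)).toH2) := fun a => by
    rw [smul_add]
    rfl
  have hcoef : ∀ t ∈ Set.Ioo (-r) r, coeffL ψ₀ (w t).toH2 = 0 := fun t ht => (hsol t ht).2
  -- With this δE the condition |E - E₀| < δE on the bifurcating side says exactly 0 < γ(E - E₀) <
  -- f(δ²), the values taken by f on (0, δ²).
  refine ⟨f (δ ^ 2) / |γ|, by positivity, δ, hδ, ε, hε, fun a => a • w (‖a‖ ^ 2), ?_,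
    zero_smul ℂ _, ?_, ?_, ?_⟩
  · intro a ha
    rw [mem_ball_zero_iff] at ha
    exact (ContDiffAt.smul_comp_norm_sq (X := WeightedH2 σ)
      (hw _ (hmem a ha).2)).contDiffWithinAt
  · intro a ha
    obtain ⟨ha1, ha2⟩ := hmem a ha
    refine ⟨?_, fun θ => ?_, ?_, E₀ + f (‖a‖ ^ 2) / γ, ?_, ?_⟩
    · have h1 : (inner ℂ ψ₀.fn (a • w (‖a‖ ^ 2)).toH2.fn : ℂ) =
          coeffL ψ₀ (a • (w (‖a‖ ^ 2)).toH2) := rfl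
      rw [h1, map_smul, hcoef _ ha2, smul_zero]
    · exact phase_smul_comp_norm_sq w θ a
    · rw [hpt]
      exact hδ₁ε (by rw [dist_zero_right]; exact ha.trans hδδ₁)
    · have h1 : 0 ≤ f (‖a‖ ^ 2) := by
        rw [← hf0]
        exact hmono.monotoneOn hmem0 ha2 (sq_nonneg _)
      rw [add_sub_cancel_left, abs_div, abs_of_nonneg h1]
      gcongr
      exact hmono ha2 hδmem ha1
    · rw [hpt]
      -- The scaling equivalence requires a ≠ 0; at a = 0 the zero function solves the equation for
      -- every energy.
      by_cases ha0 : a = 0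
      · rw [ha0, zero_smul]
        exact solvesNLS_zero hV _ _
      · rw [solvesNLS_smul_iff hV h₀ _ (hcoef _ ha2) ha0, add_sub_cancel_left]
        exact hsol _ ha2
  · intro E hE hEγ
    have hshift : γ * (E - E₀) < f (δ ^ 2) := by
      rw [lt_div_iff₀ hγ', mul_comm, ← abs_mul, abs_of_pos hEγ] at hE
      exact hE
    have hIVT : γ * (E - E₀) ∈ f '' Set.Ioo 0 (δ ^ 2) := by
      refine intermediate_value_Ioo (sq_nonneg δ) (fun t ht => ?_) ⟨by rwa [hf0], hshift⟩
      exact (hfc t ⟨by linarith [ht.1], ht.2.trans_lt hδr⟩).continuousWithinAt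
    obtain ⟨t, ⟨ht0, htδ⟩, hft⟩ := hIVT
    have htmem : t ∈ Set.Ioo (-r) r := ⟨by linarith, htδ.trans hδr⟩
    have hnt : ‖((√t : ℝ) : ℂ)‖ = √t := by
      rw [Complex.norm_real, Real.norm_of_nonneg (Real.sqrt_nonneg t)]
    have hnt2 : ‖((√t : ℝ) : ℂ)‖ ^ 2 = t := by rw [hnt, Real.sq_sqrt ht0.le]
    have ht1 : ((√t : ℝ) : ℂ) ≠ 0 := Complex.ofReal_ne_zero.2 (Real.sqrt_pos.2 ht0).ne'
    refine ⟨((√t : ℝ) : ℂ), ht1, ?_, ?_, ?_⟩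
    · rw [hnt, Real.sqrt_lt' hδ]
      exact htδ
    · rw [hpt, hnt2, solvesNLS_smul_iff hV h₀ _ (hcoef _ htmem) ht1, hnt2]
      have h1 := hsol t htmem
      rwa [hft, mul_div_cancel_left₀ _ hγ] at h1
    · intro ψ hψ0 hψε hψ
      obtain ⟨a, ha, har, hψa, hfa⟩ := hloc ψ E hψ0 hψε (hE.trans hδE) hψ
      -- The energy determines |a|² since f is injective; only the phase of a relative to √t remains
      -- free.
      have hat : ‖a‖ ^ 2 = t :=
        hmono.injOn ⟨by linarith [sq_nonneg ‖a‖], har⟩ htmem (hfa.trans hft.symm)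
      obtain ⟨θ, hθ, haθ⟩ := exists_phase (a := a) (b := ((√t : ℝ) : ℂ))
        (by rw [hnt, ← hat, Real.sqrt_sq (norm_nonneg a)]) (by simp) (by simp)
      refine ⟨θ, hθ, ?_⟩
      rw [hpt, hnt2, smul_smul, ← haθ, hψa, hat]
  · intro E hE hEγ ψ hψε hψ
    by_contra hψ0
    obtain ⟨a, ha, har, -, hfa⟩ := hloc ψ E hψ0 hψε (hE.trans hδE) hψ
    -- A nonzero solution would have γ(E - E₀) = f(|a|²) > f(0) = 0.
    have h1 : f 0 < f (‖a‖ ^ 2) := hmono hmem0 ⟨by linarith [sq_nonneg ‖a‖], har⟩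
      (pow_pos (norm_pos_iff.2 ha) 2)
    rw [hf0, hfa] at h1
    exact absurd h1 hEγ.not_gt
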